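/- Graphs are multigraphs (loops and multiple edges allowed); each edge $\{e,\bar e\}$ has two orientations, and an oriented edge $e$ has a source $s(e)$ and a target $t(e)$. The fundamental group of a graph is that of its realization as a one-dimensional CW complex. Let $L\subset\mathbb R^d$ be a Bravais lattice, i.e. the image of an injective group homomorphism $\mathbb Z^d\to\mathbb R^d$ (discreteness of $L$ is not needed), let $V\subset\mathbb R^d$ be finite, and let $\Lambda=L(V)=\{g+a : g\in L,\ a\in V\}$. Let $\Gamma=\Gamma_\Lambda$ be a graph with vertex set $\Lambda$ on which $L$ acts, by translation on the vertices and compatibly on the oriented edges (for instance the nearest-neighbour graph of $\Lambda$). Let $\bar\Gamma=\Gamma/L$ be the quotient graph, whose vertices and oriented edges are the $L$-orbits of those of $\Gamma$, let $p:\Gamma\to\bar\Gamma$ be the projection, and assume that $\bar\Gamma$ is finite. An oriented edge of $\bar\Gamma$ has a well-defined vector in $\mathbb R^d$, namely the position of the target minus the position of the source of any oriented edge of $\Gamma$ representing it; the displacement vector $\vec l$ of an edge path $l$ in $\bar\Gamma$ is the sum of the vectors of its oriented edges. Let $\tau$ be a spanning tree of $\bar\Gamma$ with root $v_0$, put $n=|E(\bar\Gamma)|-|E(\tau)|$,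 and let $\pi:\bar\Gamma\to\bar\Gamma/\tau\simeq\bigvee_{i=1}^n S^1$ be the contraction of $\tau$. Let $l_1,\dots,l_n$ be closed edge paths in $\bar\Gamma$ based at $v_0$ whose classes are lifts of generators of $\pi_1(\bar\Gamma/\tau)$, i.e. $\pi_*[l_1],\dots,\pi_*[l_n]$ generate $\pi_1(\bar\Gamma/\tau,\pi(v_0))$. Suppose that $\vec l_1,\dots,\vec l_n$ are linearly independent over $\mathbb R$. Then: 1. $\pi_1(\bar\Gamma,v_0)$ is isomorphic to the free group $\mathbb F_n$, and for every vertex $x$ of $\Gamma$ the homomorphism $p_*:\pi_1(\Gamma,x)\to\pi_1(\bar\Gamma,p(x))$ is injective with image the commutator subgroup of $\pi_1(\bar\Gamma,p(x))$. In particular $\pi_1(\Gamma,x)\cong[\mathbb F_n,\mathbb F_n]$. 2. For every closed edge path $c$ in $\bar\Gamma$, based at a vertex $y$, and every vertex $x$ of $\Gamma$ with $p(x)=y$: $c$ lifts to a closed edge path of $\Gamma$ based at $x$ if and only if $c$ traverses each edge of $\bar\Gamma$ equally often in each of its two directions. -/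

import Mathlib

universe u v w

noncomputable section

/-! ### Graphs: vertices and oriented edges -/

/-- A graph with vertex set `V` (loops and multiple edges are allowed), given by its oriented
edges `D`: every oriented edge has a source, a target and an opposite orientation.
An (unoriented) edge is a pair `{e, rev e}`. -/
structure Multigraph (V : Type u) where
  D : Type v
  src : D → V
  tgt : D → V
  rev : D → D
  rev_rev : ∀ e, rev (rev e) = e
  rev_ne : ∀ e, rev e ≠ e
  src_rev : ∀ e, src (rev e) = tgt e

namespace Multigraph

variable {V : Type u} (G : Multigraph.{u, v} V)

/-- The edges of `G`: oriented edges up to reversal of the orientation. -/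
def Edge : Type v := Quot (fun e e' : G.D => e' = G.rev e)

/-- The edge underlying an oriented edge. -/
def edge (e : G.D) : G.Edge := Quot.mk _ e

/-- The gluing of the realization: an interval `{e} × [0,1]` for every oriented edge `e` is
attached to the source and the target of `e`, and the intervals of the two orientations of an
edge are identified by `t ↦ 1 - t`. -/
inductive Glue : (Σ _ : V, PUnit.{1}) ⊕ (Σ _ : G.D, unitInterval) →
    (Σ _ : V, PUnit.{1}) ⊕ (Σ _ : G.D, unitInterval) → Prop
  | src (e : G.D) : Glue (Sum.inr ⟨e, 0⟩) (Sum.inl ⟨G.src e, PUnit.unit⟩)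
  | tgt (e : G.D) : Glue (Sum.inr ⟨e, 1⟩) (Sum.inl ⟨G.tgt e, PUnit.unit⟩)
  | rev (e : G.D) (t : unitInterval) : Glue (Sum.inr ⟨G.rev e, t⟩) (Sum.inr ⟨e, unitInterval.symm t⟩)

/-- The realization of `G` as a one-dimensional CW complex: the quotient space of the
disjoint union of one point per vertex and one interval per oriented edge. -/
def Realization : Type (max u v) := Quot G.Glue

instance : TopologicalSpace G.Realization :=
  inferInstanceAs (TopologicalSpace (Quot G.Glue))

/-- The point of the realization given by a vertex. -/
def pt (x : V) : G.Realization := Quot.mk _ (Sum.inl ⟨x, PUnit.unit⟩)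

/-- The point with parameter `t` on the oriented edge `e` in the realization. -/
def onEdge (e : G.D) (t : unitInterval) : G.Realization := Quot.mk _ (Sum.inr ⟨e, t⟩)

/-- The path along an oriented edge. -/
def edgePath (e : G.D) : Path (G.pt (G.src e)) (G.pt (G.tgt e)) where
  toFun t := G.onEdge e t
  continuous_toFun :=
    continuous_quot_mk.comp (continuous_inr.comp
      (continuous_sigmaMk (σ := fun _ : G.D => unitInterval) (i := e)))
  source' := Quot.sound (Glue.src e)
  target' := Quot.sound (Glue.tgt e)

/-- Edge paths of `G` from a vertex to a vertex. -/
inductive Walk : V → V → Type (max u v)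
  | nil (x : V) : Walk x x
  | cons {y : V} (e : G.D) (p : Walk (G.tgt e) y) : Walk (G.src e) y

namespace Walk

variable {G}

/-- The sequence of oriented edges of an edge path. -/
def darts : {x y : V} → G.Walk x y → List G.D
  | _, _, nil _ => []
  | _, _, cons e p => e :: p.darts

/-- The path in the realization given by an edge path. -/
def toPath : {x y : V} → G.Walk x y → Path (G.pt x) (G.pt y)
  | _, _, nil x => Path.refl (G.pt x)
  | _, _, cons e p => (G.edgePath e).trans p.toPath

/-- The class of a closed edge path in the fundamental group of the realization. -/
def toPi1 {x : V} (p : G.Walk x x) : FundamentalGroup G.Realization (G.pt x) :=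
  FundamentalGroup.fromPath (Path.Homotopic.Quotient.mk p.toPath)

/-- An edge path is reduced if no oriented edge is followed by its opposite. -/
def IsReduced {x y : V} (p : G.Walk x y) : Prop :=
  p.darts.IsChain (fun a b => b ≠ G.rev a)

open Classical in
/-- Every edge is traversed equally often in each of its two directions. -/
def IsBalanced {x y : V} (p : G.Walk x y) : Prop :=
  ∀ e : G.D, p.darts.count e = p.darts.count (G.rev e)

end Walk

/-- A rooted spanning tree: a root together with a subgraph that contains all vertices (given
by the set of its oriented edges), is connected, and has no nontrivial reduced closed edge
path. -/
structure RootedSpanningTree where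
  root : V
  darts : Set G.D
  rev_mem : ∀ e ∈ darts, G.rev e ∈ darts
  connected : ∀ x y : V, ∃ p : G.Walk x y, ∀ e ∈ p.darts, e ∈ darts
  acyclic : ∀ (x : V) (p : G.Walk x x), (∀ e ∈ p.darts, e ∈ darts) → p.IsReduced → p.darts = []

namespace RootedSpanningTree

variable {G} (τ : G.RootedSpanningTree)

/-- The edges of the tree. -/
def edges : Set G.Edge := G.edge '' τ.darts

/-- The realization of the tree, as a subset of the realization of the graph. -/
def points : Set G.Realization :=
  Set.range G.pt ∪ {z | ∃ e ∈ τ.darts, ∃ t : unitInterval, z = G.onEdge e t}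

/-- The space obtained from the realization of the graph by contracting the tree to a point;
a wedge of circles, one for every edge outside the tree. -/
def Contraction : Type (max u v) := Quot (fun z z' : G.Realization => z ∈ τ.points ∧ z' ∈ τ.points)

instance : TopologicalSpace τ.Contraction :=
  inferInstanceAs (TopologicalSpace (Quot _))

/-- The contraction of the tree. -/
def contract : C(G.Realization, τ.Contraction) where
  toFun := Quot.mk _
  continuous_toFun := continuous_quot_mk

end RootedSpanningTree

/-- A morphism of graphs. -/
structure Hom {V : Type u} {W : Type w} (G : Multigraph.{u, v} V) (H : Multigraph.{w, v} W) where
  onV : V → W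
  onD : G.D → H.D
  src_onD : ∀ e, H.src (onD e) = onV (G.src e)
  tgt_onD : ∀ e, H.tgt (onD e) = onV (G.tgt e)
  rev_onD : ∀ e, H.rev (onD e) = onD (G.rev e)

/-- The continuous map of realizations induced by a morphism of graphs. -/
def Hom.realize {V : Type u} {W : Type w} {G : Multigraph.{u, v} V} {H : Multigraph.{w, v} W}
    (f : G.Hom H) : C(G.Realization, H.Realization) where
  toFun := Quot.lift
    (Sum.elim (fun x => H.pt (f.onV x.1)) (fun x => H.onEdge (f.onD x.1) x.2)) (by
      rintro _ _ (e | e | ⟨e, t⟩)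
      · exact (Quot.sound (Glue.src (f.onD e))).trans (congrArg H.pt (f.src_onD e))
      · exact (Quot.sound (Glue.tgt (f.onD e))).trans (congrArg H.pt (f.tgt_onD e))
      · change H.onEdge (f.onD (G.rev e)) t = _
        rw [← f.rev_onD]
        exact Quot.sound (Glue.rev (f.onD e) t))
  continuous_toFun := by
    refine continuous_quot_lift _ (Continuous.sumElim ?_ ?_)
    · exact continuous_sigma fun x => continuous_of_const fun _ _ => rfl
    · exact continuous_sigma fun e => continuous_quot_mk.comp (continuous_inr.comp
        (continuous_sigmaMk (σ := fun _ : H.D => unitInterval) (i := f.onD e)))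

end Multigraph

/-! ### Lattices and their graphs -/

/-- A crystal structure `(L, V)` in `ℝ^d`: a Bravais lattice `L`, i.e. the image of an injective
group homomorphism `ℤ^d → ℝ^d`, and a finite set `V`. -/
structure CrystalStructure (d : ℕ) where
  L : AddSubgroup (EuclideanSpace ℝ (Fin d))
  bravais : ∃ ρ : (Fin d → ℤ) →+ EuclideanSpace ℝ (Fin d), Function.Injective ρ ∧ ρ.range = L
  V : Set (EuclideanSpace ℝ (Fin d))
  finite_V : V.Finite

namespace CrystalStructure

variable {d : ℕ} (C : CrystalStructure d)

/-- The lattice `Λ = L(V)`: all translates of points of `V` by elements of `L`. -/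
def lattice : Set (EuclideanSpace ℝ (Fin d)) :=
  {x | ∃ g ∈ C.L, ∃ a ∈ C.V, x = g + a}

/-- `L` acts on `Λ` by translations. -/
instance : AddAction C.L C.lattice where
  vadd g x := ⟨(g : EuclideanSpace ℝ (Fin d)) + x, by
    obtain ⟨h, hh, a, ha, hx⟩ := x.2
    exact ⟨g + h, C.L.add_mem g.2 hh, a, ha, by rw [hx, add_assoc]⟩⟩
  zero_vadd x := Subtype.ext (zero_add _)
  add_vadd g h x := Subtype.ext (add_assoc _ _ _)

theorem coe_vadd (g : C.L) (x : C.lattice) :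
    ((g +ᵥ x : C.lattice) : EuclideanSpace ℝ (Fin d)) = (g : EuclideanSpace ℝ (Fin d)) + x := rfl

end CrystalStructure

/-- A graph whose vertices are the points of the lattice `Λ = L(V)` and on which `L` acts by
translations. -/
structure LatticeGraph {d : ℕ} (C : CrystalStructure d) extends Multigraph.{0, v} C.lattice where
  act : AddAction C.L D
  src_vadd : ∀ (g : C.L) (e : D), src (g +ᵥ e) = g +ᵥ src e
  tgt_vadd : ∀ (g : C.L) (e : D), tgt (g +ᵥ e) = g +ᵥ tgt e
  rev_vadd : ∀ (g : C.L) (e : D), rev (g +ᵥ e) = g +ᵥ rev e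

namespace LatticeGraph

variable {d : ℕ} {C : CrystalStructure d} (Γ : LatticeGraph.{v} C)

instance : AddAction C.L Γ.D := Γ.act

/-- The class of a vertex modulo `L`. -/
def projV (x : C.lattice) : AddAction.orbitRel.Quotient C.L C.lattice := Quotient.mk'' x

/-- The class of an oriented edge modulo `L`. -/
def projD (e : Γ.D) : AddAction.orbitRel.Quotient C.L Γ.D := Quotient.mk'' e

theorem projV_vadd (g : C.L) (x : C.lattice) : projV (g +ᵥ x) = projV x :=
  Quotient.sound' ⟨g, rfl⟩

theorem projD_vadd (g : C.L) (e : Γ.D) : Γ.projD (g +ᵥ e) = Γ.projD e :=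
  Quotient.sound' ⟨g, rfl⟩

/-- A translation never reverses an edge. -/
theorem rev_ne_vadd (g : C.L) (e : Γ.D) : g +ᵥ e ≠ Γ.rev e := by
  intro h
  have h1 : g +ᵥ Γ.src e = Γ.tgt e := by rw [← Γ.src_vadd, h, Γ.src_rev]
  have h2 : g +ᵥ Γ.tgt e = Γ.src e := by
    rw [← Γ.tgt_vadd, h, ← Γ.src_rev, Γ.rev_rev]
  have h3 := congrArg Subtype.val h1
  have h4 := congrArg Subtype.val h2
  rw [C.coe_vadd] at h3 h4
  have h5 : (2 : ℝ) • (g : EuclideanSpace ℝ (Fin d)) = 0 := by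
    rw [← h3] at h4
    rw [two_smul]
    rw [← add_assoc] at h4
    simpa using h4
  have h6 : g = 0 := by
    have := (smul_eq_zero.1 h5).resolve_left two_ne_zero
    exact Subtype.ext this
  rw [h6, zero_vadd] at h
  exact Γ.rev_ne e h.symm

/-- The quotient graph of `Γ` by `L`: its vertices are the `L`-orbits of points of `Λ` and its
oriented edges are the `L`-orbits of oriented edges of `Γ`. -/
def quotient : Multigraph.{0, v} (AddAction.orbitRel.Quotient C.L C.lattice) where
  D := AddAction.orbitRel.Quotient C.L Γ.D
  src := Quotient.lift (fun e => projV (Γ.src e)) (by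
    rintro _ e ⟨g, rfl⟩
    change projV (Γ.src (g +ᵥ e)) = _
    rw [Γ.src_vadd, projV_vadd])
  tgt := Quotient.lift (fun e => projV (Γ.tgt e)) (by
    rintro _ e ⟨g, rfl⟩
    change projV (Γ.tgt (g +ᵥ e)) = _
    rw [Γ.tgt_vadd, projV_vadd])
  rev := Quotient.lift (fun e => Γ.projD (Γ.rev e)) (by
    rintro _ e ⟨g, rfl⟩
    change Γ.projD (Γ.rev (g +ᵥ e)) = _
    rw [Γ.rev_vadd, projD_vadd])
  rev_rev := by
    rintro ⟨e⟩
    exact congrArg Γ.projD (Γ.rev_rev e)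
  rev_ne := by
    rintro ⟨e⟩ h
    obtain ⟨g, hg⟩ := Quotient.exact' h
    exact Γ.rev_ne_vadd g e hg
  src_rev := by
    rintro ⟨e⟩
    exact congrArg projV (Γ.src_rev e)

/-- The projection of `Γ` to its quotient graph. -/
def proj : Γ.toMultigraph.Hom Γ.quotient where
  onV := projV
  onD := Γ.projD
  src_onD _ := rfl
  tgt_onD _ := rfl
  rev_onD _ := rfl

/-- The vector of an oriented edge of the quotient graph: target minus source of any of its
representatives in `Γ`. -/
def vec : Γ.quotient.D → EuclideanSpace ℝ (Fin d) :=
  Quotient.lift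
    (fun e : Γ.D => (Γ.tgt e : EuclideanSpace ℝ (Fin d)) - (Γ.src e : EuclideanSpace ℝ (Fin d))) (by
    rintro _ e ⟨g, rfl⟩
    change (Γ.tgt (g +ᵥ e) : EuclideanSpace ℝ (Fin d)) - (Γ.src (g +ᵥ e) : EuclideanSpace ℝ (Fin d)) = _
    rw [Γ.src_vadd, Γ.tgt_vadd, C.coe_vadd, C.coe_vadd, add_sub_add_left_eq_sub])

/-- The displacement vector of an edge path of the quotient graph: the sum of the vectors of
its oriented edges. -/
def displacement {x y : AddAction.orbitRel.Quotient C.L C.lattice} (p : Γ.quotient.Walk x y) :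
    EuclideanSpace ℝ (Fin d) :=
  (p.darts.map Γ.vec).sum

/-- `p'` is a lift of `p`: it starts over the starting vertex of `p`, and its oriented
edges are, in order, representatives of those of `p`. -/
def IsLift {x y : AddAction.orbitRel.Quotient C.L C.lattice} {x' y' : C.lattice}
    (p' : Γ.Walk x' y') (p : Γ.quotient.Walk x y) : Prop :=
  Γ.proj.onV x' = x ∧ p'.darts.map Γ.proj.onD = p.darts

end LatticeGraph

end

noncomputable section

open CategoryTheory unitInterval

namespace Multigraph

variable {V : Type u} {G : Multigraph.{u, v} V}

/-! The image of `p_*` is the kernel of the displacement homomorphism. A lift of an edge path of the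
quotient ends at its starting point plus the displacement, so a closed path lifts to a closed one
exactly when its displacement vanishes (`exists_closed_lift_iff`). Vectors commute, so commutators
have displacement zero. Conversely, the `l i` generate the fundamental group, because contracting
the tree is injective on it (`map_contract_injective`). Modulo commutators every class is therefore
a product of integer powers of the `l i`, and linear independence makes all exponents vanish when
the displacement does (`mem_commutator_of_linearIndependent`). The net number of passages through an
edge is also a homomorphism to an abelian group, so displacement zero forces balance; balance forces
displacement zero because opposite edges have opposite vectors.

The topology is reduced to combinatorics in two steps. Every homotopy class of paths between
vertices contains an edge path (`exists_walk_toHom_eq`), and the product of group labels along an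
edge path depends only on its class (`Voltage.val_eq_of_toHom_eq`), since it is read off from the
endpoint of a lift to a covering. Labels in free groups show that the fundamental group is free on
the edges outside the tree (`piEquiv`) and that nonempty reduced closed paths are not
null-homotopic. The latter gives injectivity of `p_*`: the lattice acts freely, so projection
preserves reducedness. Labels in `ℝ^d` and `ℤ` give the displacement and the counts. -/

theorem tgt_rev (e : G.D) : G.tgt (G.rev e) = G.src e := by
  rw [← G.src_rev, G.rev_rev]

/-! ### Functions on the realization: stars of vertices and interiors of edges -/

namespace Realization

/-- A map out of the realization, given on the vertices and on the edges. -/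
def lift {Y : Type w} (f : V → Y) (g : G.D → I → Y) (h0 : ∀ e, g e 0 = f (G.src e))
    (h1 : ∀ e, g e 1 = f (G.tgt e)) (hr : ∀ e t, g (G.rev e) t = g e (σ t)) :
    G.Realization → Y :=
  Quot.lift (Sum.elim (fun x => f x.1) (fun x => g x.1 x.2)) (by
    rintro _ _ (e | e | ⟨e, t⟩)
    exacts [h0 e, h1 e, hr e t])

theorem continuous_lift {Y : Type w} [TopologicalSpace Y] {f : V → Y} {g : G.D → I → Y}
    (h0 : ∀ e, g e 0 = f (G.src e)) (h1 : ∀ e, g e 1 = f (G.tgt e))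
    (hr : ∀ e t, g (G.rev e) t = g e (σ t)) (hg : ∀ e, Continuous (g e)) :
    Continuous (lift f g h0 h1 hr) := by
  refine continuous_quot_lift _ (Continuous.sumElim ?_ ?_)
  · exact continuous_sigma fun x => continuous_of_const fun _ _ => rfl
  · exact continuous_sigma hg

@[elab_as_elim]
theorem ind {P : G.Realization → Prop} (hpt : ∀ x, P (G.pt x)) (hon : ∀ e t, P (G.onEdge e t)) :
    ∀ z, P z := by
  rintro ⟨⟨x, ⟨⟩⟩ | ⟨e, t⟩⟩
  exacts [hpt x, hon e t]

end Realization

theorem onEdge_zero (e : G.D) : G.onEdge e 0 = G.pt (G.src e) := Quot.sound (Glue.src e)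

theorem onEdge_one (e : G.D) : G.onEdge e 1 = G.pt (G.tgt e) := Quot.sound (Glue.tgt e)

theorem onEdge_rev (e : G.D) (t : I) : G.onEdge (G.rev e) t = G.onEdge e (σ t) :=
  Quot.sound (Glue.rev e t)

theorem continuous_onEdge (e : G.D) : Continuous (G.onEdge e) := (G.edgePath e).continuous

open Classical in
/-- A continuous function on the realization that is positive on a neighbourhood of the
vertex `v` only. -/
def star (v : V) : G.Realization → ℝ :=
  Realization.lift (fun w => if w = v then 1 else 0)
    (fun e t => (if G.src e = v then max 0 (1 - 3 * (t : ℝ)) else 0) +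
      (if G.tgt e = v then max 0 (3 * (t : ℝ) - 2) else 0))
    (by intro e; norm_num) (by intro e; norm_num)
    (by
      intro e t
      rw [G.src_rev, tgt_rev, add_comm]
      congr 3 <;> simp only [coe_symm_eq] <;> ring_nf)

theorem continuous_star (v : V) : Continuous (star (G := G) v) := by
  refine Realization.continuous_lift _ _ _ fun e => ?_
  split_ifs <;> fun_prop

open Classical in
theorem star_pt (v w : V) : star (G := G) v (G.pt w) = if w = v then 1 else 0 := rfl

theorem eq_of_star_pt_pos {v w : V} (h : 0 < star (G := G) v (G.pt w)) : w = v := by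
  by_contra hne
  rw [star_pt, if_neg hne] at h
  exact lt_irrefl _ h

/-- The two tents of `star` live on the first and the last third of an edge, so even on a loop the
two ends of the star stay disjoint. -/
theorem star_onEdge_pos {v : V} {e : G.D} {t : I} (h : 0 < star (G := G) v (G.onEdge e t)) :
    (G.src e = v ∧ 3 * (t : ℝ) < 1) ∨ (G.tgt e = v ∧ 2 < 3 * (t : ℝ)) := by
  classical
  by_contra! hc
  refine h.not_ge ?_
  change (if G.src e = v then max 0 (1 - 3 * (t : ℝ)) else 0) +
      (if G.tgt e = v then max 0 (3 * (t : ℝ) - 2) else 0) ≤ 0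
  have h1 : (if G.src e = v then max 0 (1 - 3 * (t : ℝ)) else 0) ≤ 0 := by
    split_ifs with hs
    · exact max_le le_rfl (by linarith [hc.1 hs])
    · exact le_rfl
  have h2 : (if G.tgt e = v then max 0 (3 * (t : ℝ) - 2) else 0) ≤ 0 := by
    split_ifs with hs
    · exact max_le le_rfl (by linarith [hc.2 hs])
    · exact le_rfl
  linarith

theorem pt_injective : Function.Injective G.pt := by
  intro v w h
  refine eq_of_star_pt_pos (G := G) ?_
  rw [h, star_pt, if_pos rfl]
  exact one_pos

open Classical in
/-- A continuous function on the realization that is positive on the interior of the edge `e`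
only. -/
def bump (e : G.D) : G.Realization → ℝ :=
  Realization.lift (fun _ => 0)
    (fun f t => if f = e ∨ f = G.rev e then (t : ℝ) * (1 - t) else 0)
    (by intro f; simp) (by intro f; simp)
    (by
      intro f t
      have : (G.rev f = e ∨ G.rev f = G.rev e) ↔ (f = e ∨ f = G.rev e) := by
        constructor
        · rintro (rfl | h)
          · exact Or.inr (G.rev_rev f).symm
          · exact Or.inl (by rw [← G.rev_rev f, h, G.rev_rev])
        · rintro (rfl | rfl)
          · exact Or.inr rfl
          · exact Or.inl (G.rev_rev e)
      simp only [this, coe_symm_eq]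
      congr 1; ring)

open Classical in
/-- The product of `bump e` and the coordinate on the edge `e`. -/
def bumpCoord (e : G.D) : G.Realization → ℝ :=
  Realization.lift (fun _ => 0)
    (fun f t => if f = e then (t : ℝ) * (1 - t) * t else
      if f = G.rev e then (t : ℝ) * (1 - t) * (1 - t) else 0)
    (by intro f; simp) (by intro f; simp)
    (by
      intro f t
      by_cases h1 : f = e
      · subst h1
        simp only [G.rev_ne, if_true, if_false, coe_symm_eq]; ring
      · by_cases h2 : f = G.rev e
        · subst h2
          simp only [G.rev_rev, G.rev_ne, if_true, if_false, coe_symm_eq]; ring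
        · have h3 : G.rev f ≠ e := fun h => h2 (by rw [← h, G.rev_rev])
          have h4 : G.rev f ≠ G.rev e := fun h => h1 (by rw [← G.rev_rev f, h, G.rev_rev])
          simp only [h1, h2, h3, h4, if_false])

theorem continuous_bump (e : G.D) : Continuous (bump e) := by
  refine Realization.continuous_lift _ _ _ fun f => ?_
  split_ifs <;> fun_prop

theorem continuous_bumpCoord (e : G.D) : Continuous (bumpCoord e) := by
  refine Realization.continuous_lift _ _ _ fun f => ?_
  split_ifs <;> fun_prop

theorem bump_onEdge_pos {e f : G.D} {t : I} (h : 0 < bump e (G.onEdge f t)) :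
    f = e ∨ f = G.rev e := by
  classical
  by_contra hc
  have : bump e (G.onEdge f t) = 0 := if_neg hc
  exact h.ne' this

theorem bump_self (e : G.D) (t : I) : bump e (G.onEdge e t) = t * (1 - t) := if_pos (Or.inl rfl)

theorem bumpCoord_self (e : G.D) (t : I) : bumpCoord e (G.onEdge e t) = t * (1 - t) * t :=
  if_pos rfl

/-- The coordinate on the interior of the edge `e`. -/
def coord (e : G.D) (z : G.Realization) : I :=
  Set.projIcc 0 1 zero_le_one (bumpCoord e z / bump e z)

theorem coord_onEdge {e : G.D} {t : I} (h : 0 < bump e (G.onEdge e t)) :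
    coord e (G.onEdge e t) = t := by
  rw [bump_self] at h
  rw [coord, bump_self, bumpCoord_self, mul_div_assoc, mul_div_cancel₀]
  · exact Set.projIcc_val _ t
  · exact h.ne'

theorem exists_onEdge {e : G.D} {z : G.Realization} (h : 0 < bump e z) :
    z = G.onEdge e (coord e z) := by
  induction z using Realization.ind with
  | hpt x => exact absurd h (lt_irrefl _)
  | hon f t =>
    rcases bump_onEdge_pos h with rfl | rfl
    · rw [coord_onEdge h]
    · rw [onEdge_rev] at h ⊢
      rw [coord_onEdge h]

/-- The coordinate alone has no continuous extension by zero, but its product with `bump e` does;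
dividing by the bump recovers it on the open edge. -/
theorem continuousOn_coord (e : G.D) : ContinuousOn (coord e) {z | 0 < bump e z} := by
  refine continuous_projIcc.comp_continuousOn ?_
  exact (continuous_bumpCoord e).continuousOn.div (continuous_bump e).continuousOn
    fun z hz => (show 0 < bump e z from hz).ne'

/-- Every point of the realization lies near a vertex or in the interior of an edge. -/
theorem exists_star_or_bump (z : G.Realization) : (∃ v, 0 < star v z) ∨ ∃ e, 0 < bump e z := by
  induction z using Realization.ind with
  | hpt x =>
    refine Or.inl ⟨x, ?_⟩
    rw [star_pt, if_pos rfl]; exact one_pos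
  | hon e t =>
    rcases eq_or_ne t 0 with rfl | h0
    · refine Or.inl ⟨G.src e, ?_⟩
      rw [onEdge_zero, star_pt, if_pos rfl]; exact one_pos
    rcases eq_or_ne t 1 with rfl | h1
    · refine Or.inl ⟨G.tgt e, ?_⟩
      rw [onEdge_one, star_pt, if_pos rfl]; exact one_pos
    refine Or.inr ⟨e, ?_⟩
    rw [bump_self]
    have := unitInterval.pos_iff_ne_zero.2 h0
    have := unitInterval.lt_one_iff_ne_one.2 h1
    have h2 : (0 : ℝ) < t := by assumption
    have h3 : (t : ℝ) < 1 := by assumption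
    exact mul_pos h2 (by linarith)

/-! ### The homotopy that shrinks the stars of the vertices -/

/-- The homotopy of the interval that shrinks neighbourhoods of the endpoints. -/
def shrinkI (s t : I) : I := Set.projIcc 0 1 zero_le_one ((t : ℝ) + s * (2 * t - 1))

theorem continuous_shrinkI : Continuous fun p : I × I => shrinkI p.1 p.2 := by
  unfold shrinkI
  exact continuous_projIcc.comp (by fun_prop)

theorem shrinkI_zero (t : I) : shrinkI 0 t = t := by
  simp [shrinkI]

theorem shrinkI_left (s : I) : shrinkI s 0 = 0 := by
  have := s.2.1
  exact Set.projIcc_of_le_left _ (by simp; exact this)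

theorem shrinkI_right (s : I) : shrinkI s 1 = 1 := by
  have := s.2.1
  exact Set.projIcc_of_right_le _ (by simp; linarith)

theorem shrinkI_symm (s t : I) : shrinkI s (σ t) = σ (shrinkI s t) := by
  rw [shrinkI, shrinkI, symm_projIcc, coe_symm_eq]
  congr 1; ring

/-- At time 1 the formula is `3t - 1` clamped to the interval, which collapses exactly the outer
thirds, where the stars live. -/
theorem shrinkI_one_of_lt {t : I} (h : 3 * (t : ℝ) < 1) : shrinkI 1 t = 0 :=
  Set.projIcc_of_le_left _ (by simp; linarith)

theorem shrinkI_one_of_gt {t : I} (h : 2 < 3 * (t : ℝ)) : shrinkI 1 t = 1 :=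
  Set.projIcc_of_right_le _ (by simp; linarith)

/-- The track of a point of the realization under the homotopy `shrinkI` of every edge. -/
def shrinkTrack : G.Realization → C(I, G.Realization) :=
  Realization.lift (fun v => ContinuousMap.const _ (G.pt v))
    (fun e t => ⟨fun s => G.onEdge e (shrinkI s t),
      (continuous_onEdge e).comp
        (continuous_shrinkI.comp (continuous_id.prodMk continuous_const))⟩)
    (by intro e; ext s; simp [shrinkI_left, onEdge_zero])
    (by intro e; ext s; simp [shrinkI_right, onEdge_one])
    (by intro e t; ext s; simp [shrinkI_symm, onEdge_rev])

/-- With the time variable curried, continuity can be checked edge by edge, with no need for a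
quotient topology on the product with `I`. -/
theorem continuous_shrinkTrack : Continuous (shrinkTrack (G := G)) := by
  refine Realization.continuous_lift _ _ _ fun e => ?_
  exact ContinuousMap.continuous_of_continuous_uncurry _
    ((continuous_onEdge e).comp
      (continuous_shrinkI.comp (continuous_snd.prodMk continuous_fst : Continuous fun p : I × I => _)))

/-- The homotopy of the realization that shrinks neighbourhoods of the vertices. -/
def shrink : C(I × G.Realization, G.Realization) where
  toFun p := shrinkTrack p.2 p.1
  continuous_toFun := by
    have := continuous_shrinkTrack (G := G)
    fun_prop

theorem shrink_pt (s : I) (v : V) : shrink (s, G.pt v) = G.pt v := rfl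

theorem shrink_onEdge (s : I) (e : G.D) (t : I) :
    shrink (s, G.onEdge e t) = G.onEdge e (shrinkI s t) := rfl

theorem shrink_zero (z : G.Realization) : shrink (0, z) = z := by
  induction z using Realization.ind with
  | hpt x => rfl
  | hon e t => rw [shrink_onEdge, shrinkI_zero]

theorem shrink_one_of_star {v : V} {z : G.Realization} (h : 0 < star v z) :
    shrink (1, z) = G.pt v := by
  induction z using Realization.ind with
  | hpt x => rw [shrink_pt, eq_of_star_pt_pos h]
  | hon e t =>
    rw [shrink_onEdge]
    rcases star_onEdge_pos h with ⟨rfl, ht⟩ | ⟨rfl, ht⟩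
    · rw [shrinkI_one_of_lt ht, onEdge_zero]
    · rw [shrinkI_one_of_gt ht, onEdge_one]

end Multigraph

/-! ### Paths and homotopies in the fundamental groupoid -/

theorem unitInterval.contractibleSpace : ContractibleSpace I :=
  (convex_Icc (0 : ℝ) 1).contractibleSpace ⟨0, by simp⟩

theorem unitInterval.simplyConnectedSpace : SimplyConnectedSpace I :=
  have := unitInterval.contractibleSpace
  inferInstance

theorem unitInterval.simplyConnectedSpace_prod : SimplyConnectedSpace (I × I) :=
  have := unitInterval.contractibleSpace
  inferInstance

namespace FundamentalGroupoid

variable {X : Type u} [TopologicalSpace X]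

/-- The class of a path, as a morphism of the fundamental groupoid. -/
abbrev ofPath {a b : X} (p : Path a b) : FundamentalGroupoid.mk a ⟶ FundamentalGroupoid.mk b :=
  Path.Homotopic.Quotient.mk p

theorem ofPath_trans {a b c : X} (p : Path a b) (q : Path b c) :
    ofPath (p.trans q) = ofPath p ≫ ofPath q := rfl

theorem ofPath_refl (a : X) : ofPath (Path.refl a) = 𝟙 _ := rfl

/-- Endpoints often agree only propositionally, for instance `onEdge e 0` and `pt (src e)`; the
`eqToHom` factors absorb the difference. -/
theorem ofPath_eq {a b a' b' : X} (p : Path a b) (q : Path a' b') (ha : a = a') (hb : b = b')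
    (h : ∀ t, p t = q t) :
    ofPath p = eqToHom (congrArg _ ha) ≫ ofPath q ≫ eqToHom (congrArg _ hb.symm) := by
  subst ha hb
  obtain rfl : p = q := Path.ext (funext h)
  simp

/-- Naturality of the tracks of a homotopy. -/
theorem ofPath_square (H : C(I × X, X)) {a b : X} (δ : Path a b) :
    ofPath (δ.map (f := fun z => H (0, z)) (by fun_prop)) ≫
      ofPath (a := H (0, b)) (b := H (1, b)) ⟨⟨fun s => H (s, b), by fun_prop⟩, rfl, rfl⟩ =
    ofPath (a := H (0, a)) (b := H (1, a)) ⟨⟨fun s => H (s, a), by fun_prop⟩, rfl, rfl⟩ ≫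
      ofPath (δ.map (f := fun z => H (1, z)) (by fun_prop)) := by
  have := unitInterval.simplyConnectedSpace_prod
  let K : C(I × I, X) := ⟨fun p => H (p.1, δ p.2), by fun_prop⟩
  let p1 : Path ((0, 0) : I × I) (0, 1) := ⟨⟨fun t => (0, t), by fun_prop⟩, rfl, rfl⟩
  let p2 : Path ((0, 1) : I × I) (1, 1) := ⟨⟨fun t => (t, 1), by fun_prop⟩, rfl, rfl⟩
  let p3 : Path ((0, 0) : I × I) (1, 0) := ⟨⟨fun t => (t, 0), by fun_prop⟩, rfl, rfl⟩
  let p4 : Path ((1, 0) : I × I) (1, 1) := ⟨⟨fun t => (1, t), by fun_prop⟩, rfl, rfl⟩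
  -- The two ways around the boundary of the square are homotopic because the square is simply
  -- connected; `K` carries this to `X`.
  have h : ofPath (p1.trans p2) = ofPath (p3.trans p4) :=
    Path.Homotopic.Quotient.eq.2 (SimplyConnectedSpace.paths_homotopic _ _)
  have h2 := congrArg (FundamentalGroupoid.map K).map h
  rw [ofPath_trans, ofPath_trans, Functor.map_comp, Functor.map_comp] at h2
  change ofPath (p1.map K.continuous) ≫ ofPath (p2.map K.continuous) =
    ofPath (p3.map K.continuous) ≫ ofPath (p4.map K.continuous) at h2
  have e0 : δ 0 = a := δ.source
  have e1 : δ 1 = b := δ.target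
  rw [ofPath_eq (p1.map K.continuous) (δ.map (f := fun z => H (0, z)) (by fun_prop))
      (congrArg (fun z => H (0, z)) e0) (congrArg (fun z => H (0, z)) e1) (fun t => rfl),
    ofPath_eq (p4.map K.continuous) (δ.map (f := fun z => H (1, z)) (by fun_prop))
      (congrArg (fun z => H (1, z)) e0) (congrArg (fun z => H (1, z)) e1) (fun t => rfl),
    ofPath_eq (p2.map K.continuous) (⟨⟨fun s => H (s, b), by fun_prop⟩, rfl, rfl⟩ :
      Path (H (0, b)) (H (1, b))) (congrArg (fun z => H (0, z)) e1)
      (congrArg (fun z => H (1, z)) e1) (fun t => congrArg (fun z => H (t, z)) e1),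
    ofPath_eq (p3.map K.continuous) (⟨⟨fun s => H (s, a), by fun_prop⟩, rfl, rfl⟩ :
      Path (H (0, a)) (H (1, a))) (congrArg (fun z => H (0, z)) e0)
      (congrArg (fun z => H (1, z)) e0) (fun t => congrArg (fun z => H (t, z)) e0)] at h2
  simp only [Category.assoc, eqToHom_trans_assoc, eqToHom_refl, Category.id_comp] at h2
  rw [cancel_epi] at h2
  simpa only [← Category.assoc, cancel_mono] using h2

end FundamentalGroupoid

/-! ### Edge paths and their classes in the fundamental groupoid -/

namespace Multigraph

open FundamentalGroupoid

variable {V : Type u} {G : Multigraph.{u, v} V}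

/-- A vertex as an object of the fundamental groupoid of the realization. -/
abbrev vtx (G : Multigraph.{u, v} V) (x : V) : FundamentalGroupoid G.Realization := ⟨G.pt x⟩

/-- The class of an oriented edge in the fundamental groupoid. -/
def edgeHom (e : G.D) : G.vtx (G.src e) ⟶ G.vtx (G.tgt e) := ofPath (G.edgePath e)

namespace Walk

/-- The class of an edge path in the fundamental groupoid. -/
def toHom {x y : V} (p : G.Walk x y) : G.vtx x ⟶ G.vtx y := ofPath p.toPath

@[simp]
theorem toHom_nil (x : V) : (nil x : G.Walk x x).toHom = 𝟙 _ := rfl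

@[simp]
theorem toHom_cons {y : V} (e : G.D) (p : G.Walk (G.tgt e) y) :
    (cons e p).toHom = edgeHom e ≫ p.toHom := rfl

/-- Change the endpoints of an edge path along equalities. -/
def copy {x y x' y' : V} (p : G.Walk x y) (hx : x = x') (hy : y = y') : G.Walk x' y' :=
  hx ▸ hy ▸ p

@[simp]
theorem copy_rfl {x y : V} (p : G.Walk x y) : p.copy rfl rfl = p := rfl

@[simp]
theorem darts_copy {x y x' y' : V} (p : G.Walk x y) (hx : x = x') (hy : y = y') :
    (p.copy hx hy).darts = p.darts := by
  subst hx hy; rfl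

theorem toHom_copy {x y x' y' : V} (p : G.Walk x y) (hx : x = x') (hy : y = y') :
    (p.copy hx hy).toHom = eqToHom (congrArg _ hx.symm) ≫ p.toHom ≫ eqToHom (congrArg _ hy) := by
  subst hx hy; simp

/-- Concatenation of edge paths. -/
def append : {x y z : V} → G.Walk x y → G.Walk y z → G.Walk x z
  | _, _, _, nil _, q => q
  | _, _, _, cons e p, q => cons e (p.append q)

@[simp]
theorem toHom_append : {x y z : V} → (p : G.Walk x y) → (q : G.Walk y z) →
    (p.append q).toHom = p.toHom ≫ q.toHom
  | _, _, _, nil _, q => by simp [append]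
  | _, _, _, cons e p, q => by simp [append, toHom_append p q]

@[simp]
theorem darts_append : {x y z : V} → (p : G.Walk x y) → (q : G.Walk y z) →
    (p.append q).darts = p.darts ++ q.darts
  | _, _, _, nil _, _ => rfl
  | _, _, _, cons e p, q => congrArg (e :: ·) (darts_append p q)

/-- The edge path that consists of a single oriented edge. -/
def single (e : G.D) : G.Walk (G.src e) (G.tgt e) := cons e (nil _)

@[simp]
theorem toHom_single (e : G.D) : (single e).toHom = edgeHom e := by
  simp [single]

@[simp]
theorem darts_single (e : G.D) : (single e).darts = [e] := rfl

/-- The opposite of a single oriented edge. -/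
def singleRev (e : G.D) : G.Walk (G.tgt e) (G.src e) :=
  (single (G.rev e)).copy (G.src_rev e) (tgt_rev e)

@[simp]
theorem darts_singleRev (e : G.D) : (singleRev e).darts = [G.rev e] := by simp [singleRev]

/-- The reverse of an edge path. -/
def reverse : {x y : V} → G.Walk x y → G.Walk y x
  | _, _, nil x => nil x
  | _, _, cons e p => p.reverse.append (singleRev e)

theorem darts_reverse : {x y : V} → (p : G.Walk x y) →
    p.reverse.darts = (p.darts.map G.rev).reverse
  | _, _, nil x => rfl
  | _, _, cons e p => by simp [reverse, darts, darts_reverse p]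

end Walk

/-! ### Segments of edges -/

/-- The class of the segment of an edge between two parameters. -/
def seg (e : G.D) (s t : I) :
    (⟨G.onEdge e s⟩ : FundamentalGroupoid G.Realization) ⟶ ⟨G.onEdge e t⟩ :=
  have := unitInterval.simplyConnectedSpace
  ofPath ((PathConnectedSpace.somePath s t).map (continuous_onEdge e))

/-- The interval is simply connected, so the arbitrary path chosen in `seg` may be replaced by any
other. -/
theorem seg_eq {e : G.D} {s t : I} (p : Path s t) :
    seg e s t = ofPath (p.map (continuous_onEdge e)) :=
  have := unitInterval.simplyConnectedSpace
  Path.Homotopic.Quotient.eq.2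
    ((SimplyConnectedSpace.paths_homotopic _ p).map ⟨_, continuous_onEdge e⟩)

theorem seg_trans (e : G.D) (r s t : I) : seg e r s ≫ seg e s t = seg e r t := by
  have := unitInterval.simplyConnectedSpace
  rw [seg_eq ((PathConnectedSpace.somePath r s).trans (PathConnectedSpace.somePath s t)),
    Path.map_trans]
  rfl

theorem seg_self (e : G.D) (t : I) : seg e t t = 𝟙 _ := by
  rw [seg_eq (Path.refl t)]; rfl

theorem seg_congr (e : G.D) {s t s' t' : I} (hs : s = s') (ht : t = t') :
    seg e s t = eqToHom (by rw [hs]) ≫ seg e s' t' ≫ eqToHom (by rw [ht]) := by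
  subst hs ht; simp

theorem vtx_src (e : G.D) : (⟨G.onEdge e 0⟩ : FundamentalGroupoid G.Realization) = G.vtx (G.src e) :=
  congrArg _ (onEdge_zero e)

theorem vtx_tgt (e : G.D) : (⟨G.onEdge e 1⟩ : FundamentalGroupoid G.Realization) = G.vtx (G.tgt e) :=
  congrArg _ (onEdge_one e)

theorem seg_zero_one (e : G.D) :
    seg e 0 1 = eqToHom (vtx_src e) ≫ edgeHom e ≫ eqToHom (vtx_tgt e).symm := by
  rw [seg_eq (e := e) (⟨⟨id, continuous_id⟩, rfl, rfl⟩ : Path (0 : I) 1)]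
  exact ofPath_eq _ _ (onEdge_zero e) (onEdge_one e) fun t => rfl

theorem seg_rev (e : G.D) (s t : I) :
    seg (G.rev e) s t = eqToHom (congrArg _ (onEdge_rev e s)) ≫ seg e (σ s) (σ t) ≫
      eqToHom (congrArg _ (onEdge_rev e t).symm) := by
  have := unitInterval.simplyConnectedSpace
  rw [seg_eq (PathConnectedSpace.somePath s t),
    seg_eq ((PathConnectedSpace.somePath s t).map continuous_symm)]
  exact ofPath_eq _ _ (onEdge_rev e s) (onEdge_rev e t) fun r => onEdge_rev e _

theorem edgeHom_eq_seg (e : G.D) :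
    edgeHom e = eqToHom (vtx_src e).symm ≫ seg e 0 1 ≫ eqToHom (vtx_tgt e) := by
  simp [seg_zero_one]

/-- The reversed edge is the segment from 1 to 0, which is inverse to the segment from 0 to 1 by
`seg_trans` and `seg_self`. -/
theorem edgeHom_rev (e : G.D) : edgeHom (G.rev e) =
    eqToHom (congrArg G.vtx (G.src_rev e)) ≫ Groupoid.inv (edgeHom e) ≫
      eqToHom (congrArg G.vtx (tgt_rev e).symm) := by
  have h : seg e 1 0 = Groupoid.inv (seg e 0 1) := by
    rw [← cancel_mono (seg e 0 1), seg_trans, seg_self, Groupoid.inv_comp]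
  rw [edgeHom_eq_seg, seg_rev, seg_congr e symm_zero symm_one, h, seg_zero_one]
  simp

@[simp]
theorem Walk.toHom_singleRev (e : G.D) : (Walk.singleRev e).toHom = Groupoid.inv (edgeHom e) := by
  rw [Walk.singleRev, Walk.toHom_copy, Walk.toHom_single, edgeHom_rev]
  simp

@[simp]
theorem Walk.toHom_reverse : {x y : V} → (p : G.Walk x y) →
    p.reverse.toHom = Groupoid.inv p.toHom
  | _, _, nil x => by simp [reverse]
  | _, _, cons e p => by simp [reverse, toHom_reverse p]

/-! ### Every path between vertices is homotopic to an edge path -/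

/-- The classes of the paths that run from a point of an edge to its source along that edge, and
of the constant paths at the vertices. -/
inductive IsSeg : (z : G.Realization) → (x : V) →
    ((⟨z⟩ : FundamentalGroupoid G.Realization) ⟶ G.vtx x) → Prop
  | pt (x : V) : IsSeg (G.pt x) x (𝟙 _)
  | edge (e : G.D) (t : I) : IsSeg (G.onEdge e t) (G.src e) (seg e t 0 ≫ eqToHom (vtx_src e))

theorem exists_isSeg (z : G.Realization) : ∃ x r, IsSeg z x r := by
  induction z using Realization.ind with
  | hpt x => exact ⟨_, _, .pt x⟩
  | hon e t => exact ⟨_, _, .edge e t⟩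

/-- The classes of paths that are edge paths up to segments at the ends. -/
def IsEdgy {a b : G.Realization} (q : (⟨a⟩ : FundamentalGroupoid G.Realization) ⟶ ⟨b⟩) : Prop :=
  ∀ x r, IsSeg a x r → ∀ y s, IsSeg b y s → ∃ p : G.Walk x y, q ≫ s = r ≫ p.toHom

/-- Since `IsEdgy` quantifies over all end segments, both factors can be tested against one and the
same segment at `b`. -/
theorem IsEdgy.comp {a b c : G.Realization} {q : (⟨a⟩ : FundamentalGroupoid G.Realization) ⟶ ⟨b⟩}
    {q' : (⟨b⟩ : FundamentalGroupoid G.Realization) ⟶ ⟨c⟩} (h : IsEdgy q) (h' : IsEdgy q') :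
    IsEdgy (q ≫ q') := by
  intro x r hr y s hs
  obtain ⟨z, m, hm⟩ := exists_isSeg b
  obtain ⟨p, hp⟩ := h x r hr z m hm
  obtain ⟨p', hp'⟩ := h' z m hm y s hs
  refine ⟨p.append p', ?_⟩
  rw [Walk.toHom_append, Category.assoc, hp', ← Category.assoc, hp, Category.assoc]

/-- Local criterion: `q` is `ra` followed by the inverse of `rb`, and each of these differs from any
end segment by an edge path. -/
theorem isEdgy_of_common {a b : G.Realization} {v : V}
    (q : (⟨a⟩ : FundamentalGroupoid G.Realization) ⟶ ⟨b⟩)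
    (ra : (⟨a⟩ : FundamentalGroupoid G.Realization) ⟶ G.vtx v)
    (rb : (⟨b⟩ : FundamentalGroupoid G.Realization) ⟶ G.vtx v) (h : q ≫ rb = ra)
    (ha : ∀ x r, IsSeg a x r → ∃ p : G.Walk x v, ra = r ≫ p.toHom)
    (hb : ∀ x r, IsSeg b x r → ∃ p : G.Walk x v, rb = r ≫ p.toHom) : IsEdgy q := by
  intro x r hr y s hs
  obtain ⟨p, hp⟩ := ha x r hr
  obtain ⟨p', hp'⟩ := hb y s hs
  refine ⟨p.append p'.reverse, ?_⟩
  rw [Walk.toHom_append, Walk.toHom_reverse, ← Category.assoc, ← hp, ← h, hp']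
  simp

/-- The track of a point near a vertex under the shrinking homotopy. -/
def starTrack {v : V} {z : G.Realization} (h : 0 < star v z) : Path z (G.pt v) where
  toFun s := shrink (s, z)
  source' := shrink_zero z
  target' := shrink_one_of_star h

theorem starTrack_eq {v : V} {z : G.Realization} (h : 0 < star v z) {x : V}
    {r : (⟨z⟩ : FundamentalGroupoid G.Realization) ⟶ G.vtx x} (hr : IsSeg z x r) :
    ∃ p : G.Walk x v, ofPath (starTrack h) = r ≫ p.toHom := by
  cases hr with
  | pt =>
    obtain rfl := eq_of_star_pt_pos h
    exact ⟨Walk.nil _, by simp; rfl⟩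
  | edge e t =>
    have key (u : I) (hu : shrinkI 1 t = u) : ofPath (starTrack h) =
        seg e t u ≫ eqToHom (congrArg _ (by
          rw [← hu, ← shrink_onEdge]; exact shrink_one_of_star h)) := by
      subst hu
      let p : Path t (shrinkI 1 t) := ⟨⟨fun s => shrinkI s t,
        continuous_shrinkI.comp (continuous_id.prodMk continuous_const)⟩, shrinkI_zero t, rfl⟩
      rw [seg_eq p, ofPath_eq (starTrack h) (p.map (continuous_onEdge e)) rfl
        (shrink_one_of_star h).symm fun s => rfl]
      simp
    rcases star_onEdge_pos h with ⟨rfl, ht⟩ | ⟨rfl, ht⟩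
    · refine ⟨Walk.nil _, ?_⟩
      rw [key 0 (shrinkI_one_of_lt ht)]
      simp
    · refine ⟨Walk.single e, ?_⟩
      rw [key 1 (shrinkI_one_of_gt ht), Walk.toHom_single, edgeHom_eq_seg, ← seg_trans e t 0 1]
      simp

/-- Shrinking makes `δ` constant at `v`, so the naturality square expresses `δ` through the tracks
of its endpoints. -/
theorem isEdgy_of_star {v : V} {a b : G.Realization} (δ : Path a b)
    (h : ∀ t, 0 < star v (δ t)) : IsEdgy (ofPath δ) := by
  have ha : 0 < star v a := by simpa using h 0
  have hb : 0 < star v b := by simpa using h 1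
  refine isEdgy_of_common (ofPath δ) (ofPath (starTrack ha)) (ofPath (starTrack hb)) ?_
    (fun x r hr => starTrack_eq ha hr) (fun x r hr => starTrack_eq hb hr)
  have sq := ofPath_square shrink δ
  rw [ofPath_eq (δ.map (f := fun z => shrink (0, z)) (by fun_prop)) δ (shrink_zero a)
      (shrink_zero b) (fun t => shrink_zero _),
    ofPath_eq (δ.map (f := fun z => shrink (1, z)) (by fun_prop)) (Path.refl (G.pt v))
      (shrink_one_of_star ha) (shrink_one_of_star hb) (fun t => shrink_one_of_star (h t)),
    ofPath_eq _ (starTrack ha) (shrink_zero a) (shrink_one_of_star ha) fun t => rfl,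
    ofPath_eq _ (starTrack hb) (shrink_zero b) (shrink_one_of_star hb) fun t => rfl,
    ofPath_refl] at sq
  simp only [Category.assoc, eqToHom_trans_assoc, eqToHom_refl, Category.id_comp, cancel_epi] at sq
  simpa only [← Category.assoc, cancel_mono, Category.comp_id, eqToHom_trans, eqToHom_refl]
    using sq

/-- The path to the source of an edge from a point in its interior. -/
def bumpHom {e : G.D} {z : G.Realization} (h : 0 < bump e z) :
    (⟨z⟩ : FundamentalGroupoid G.Realization) ⟶ G.vtx (G.src e) :=
  eqToHom (congrArg _ (exists_onEdge h)) ≫ seg e (coord e z) 0 ≫ eqToHom (vtx_src e)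

theorem bumpHom_eq {e : G.D} {z : G.Realization} (h : 0 < bump e z) {x : V}
    {r : (⟨z⟩ : FundamentalGroupoid G.Realization) ⟶ G.vtx x} (hr : IsSeg z x r) :
    ∃ p : G.Walk x (G.src e), bumpHom h = r ≫ p.toHom := by
  cases hr with
  | pt => exact absurd h (lt_irrefl _)
  | edge f t =>
    rcases bump_onEdge_pos h with rfl | rfl
    · refine ⟨Walk.nil _, ?_⟩
      rw [bumpHom, seg_congr f (coord_onEdge h) rfl]
      simp
    · refine ⟨(Walk.single (G.rev e)).copy rfl (tgt_rev e), ?_⟩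
      have hc : coord e (G.onEdge (G.rev e) t) = σ t := by
        have h' := h
        rw [onEdge_rev] at h' ⊢
        exact coord_onEdge h'
      rw [bumpHom, Walk.toHom_copy, Walk.toHom_single, edgeHom_eq_seg,
        seg_congr e hc (symm_one).symm]
      have h1 : seg (G.rev e) t 0 ≫ seg (G.rev e) 0 1 = seg (G.rev e) t 1 := seg_trans ..
      rw [seg_rev e t 1] at h1
      simp only [Category.assoc, eqToHom_trans_assoc, eqToHom_refl, Category.id_comp,
        reassoc_of% h1, eqToHom_trans]

theorem isEdgy_of_bump {e : G.D} {a b : G.Realization} (δ : Path a b)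
    (h : ∀ t, 0 < bump e (δ t)) : IsEdgy (ofPath δ) := by
  have ha : 0 < bump e a := by simpa using h 0
  have hb : 0 < bump e b := by simpa using h 1
  refine isEdgy_of_common (ofPath δ) (bumpHom ha) (bumpHom hb) ?_
    (fun x r hr => bumpHom_eq ha hr) (fun x r hr => bumpHom_eq hb hr)
  let p : Path (coord e a) (coord e b) :=
    ⟨⟨fun t => coord e (δ t), (continuousOn_coord e).comp_continuous δ.continuous h⟩,
      by simp, by simp⟩
  rw [ofPath_eq δ (p.map (continuous_onEdge e)) (exists_onEdge ha) (exists_onEdge hb)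
    fun t => exists_onEdge (h t), ← seg_eq, bumpHom, bumpHom, ← seg_trans e (coord e a) (coord e b) 0]
  simp

theorem IsEdgy.of_cast {a b a' b' : G.Realization} {γ : Path a b} {ha : a' = a} {hb : b' = b}
    (h : IsEdgy (ofPath (γ.cast ha hb))) : IsEdgy (ofPath γ) := by
  subst ha hb
  exact h

/-- Stars and open edges cover the realization, so compactness of the interval cuts `γ` into
finitely many pieces, each inside one of them. -/
theorem isEdgy_ofPath {a b : G.Realization} (γ : Path a b) : IsEdgy (ofPath γ) := by
  let c : V ⊕ G.D → Set I := Sum.elim (fun v => {t | 0 < star v (γ t)})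
    (fun e => {t | 0 < bump e (γ t)})
  have hc : ∀ i, IsOpen (c i) := by
    rintro (v | e)
    · exact isOpen_lt continuous_const ((continuous_star v).comp γ.continuous)
    · exact isOpen_lt continuous_const ((continuous_bump e).comp γ.continuous)
  have hcov : Set.univ ⊆ ⋃ i, c i := by
    intro t _
    rcases exists_star_or_bump (γ t) with ⟨v, hv⟩ | ⟨e, he⟩
    · exact Set.mem_iUnion.2 ⟨Sum.inl v, hv⟩
    · exact Set.mem_iUnion.2 ⟨Sum.inr e, he⟩
  obtain ⟨t, t0, tm, ⟨n, hn⟩, ht⟩ := exists_monotone_Icc_subset_open_cover_unitInterval hc hcov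
  have piece (k : ℕ) : IsEdgy (ofPath (γ.subpath (t k) (t (k + 1)))) := by
    have hr (s : I) : ∃ r ∈ Set.Icc (t k) (t (k + 1)), γ.subpath (t k) (t (k + 1)) s = γ r := by
      have : γ.subpath (t k) (t (k + 1)) s ∈ Set.range (γ.subpath (t k) (t (k + 1))) := ⟨s, rfl⟩
      rw [γ.range_subpath_of_le _ _ (tm k.le_succ)] at this
      obtain ⟨r, hr, e⟩ := this
      exact ⟨r, hr, e.symm⟩
    obtain ⟨v | e, hi⟩ := ht k
    · refine isEdgy_of_star (v := v) _ fun s => ?_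
      obtain ⟨r, hr, e⟩ := hr s
      rw [e]; exact hi hr
    · refine isEdgy_of_bump (e := e) _ fun s => ?_
      obtain ⟨r, hr, e⟩ := hr s
      rw [e]; exact hi hr
  have all (k : ℕ) : IsEdgy (ofPath (γ.subpath (t 0) (t (k + 1)))) := by
    induction k with
    | zero => exact piece 0
    | succ k ih =>
      have := ih.comp (piece (k + 1))
      rwa [← ofPath_trans, ofPath, Path.Homotopic.Quotient.eq.2
        ⟨Path.Homotopy.subpathTransSubpath γ (t 0) (t (k + 1)) (t (k + 1 + 1))⟩] at this
  have h1 := all n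
  rw [t0, hn (n + 1) (by omega), Path.subpath_zero_one] at h1
  exact h1.of_cast

/-- Every morphism between vertices in the fundamental groupoid of the realization of a graph is
the class of an edge path. -/
theorem exists_walk_toHom_eq {x y : V} (q : G.vtx x ⟶ G.vtx y) :
    ∃ p : G.Walk x y, p.toHom = q := by
  obtain ⟨γ, rfl⟩ := Path.Homotopic.Quotient.mk_surjective q
  obtain ⟨p, hp⟩ := isEdgy_ofPath γ x _ (.pt x) y _ (.pt y)
  refine ⟨p, ?_⟩
  simpa using hp.symm

/-! ### Voltages and the coverings they define -/

/-- The vertex summand is discrete and imposes no condition. -/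
theorem Realization.isOpen_iff {U : Set G.Realization} :
    IsOpen U ↔ ∀ e, IsOpen (G.onEdge e ⁻¹' U) := by
  refine ⟨fun h e => h.preimage (continuous_onEdge e), fun h => ?_⟩
  refine isQuotientMap_quot_mk.isOpen_preimage.1 (isOpen_sum_iff.2 ⟨?_, ?_⟩)
  · exact isOpen_sigma_iff.2 fun _ => isOpen_discrete _
  · exact isOpen_sigma_iff.2 h

/-- An assignment of group elements to the oriented edges that is compatible with the change of
orientation. -/
structure Voltage (G : Multigraph.{u, v} V) (F : Type w) [Group F] where
  toFun : G.D → F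
  map_rev : ∀ e, toFun (G.rev e) = (toFun e)⁻¹

variable {F : Type w} [Group F] (α : G.Voltage F)

namespace Walk

/-- The product of the voltages along an edge path, in the order of the multiplication of
fundamental groups. -/
def val : {x y : V} → G.Walk x y → F
  | _, _, nil _ => 1
  | _, _, cons e p => p.val * α.toFun e

theorem val_eq_prod : {x y : V} → (p : G.Walk x y) →
    p.val α = (p.darts.map α.toFun).reverse.prod
  | _, _, nil _ => rfl
  | _, _, cons e p => by simp [val, darts, val_eq_prod p]

@[simp]
theorem val_append {x y z : V} (p : G.Walk x y) (q : G.Walk y z) :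
    (p.append q).val α = q.val α * p.val α := by
  simp [val_eq_prod]

@[simp]
theorem val_reverse {x y : V} (p : G.Walk x y) : p.reverse.val α = (p.val α)⁻¹ := by
  simp [val_eq_prod, darts_reverse, List.prod_inv_reverse, α.map_rev, Function.comp_def]

end Walk

namespace Voltage

/-- The graph derived from a voltage assignment. -/
def derived : Multigraph.{max u w, max v w} (V × F) where
  D := G.D × F
  src e := (G.src e.1, e.2)
  tgt e := (G.tgt e.1, α.toFun e.1 * e.2)
  rev e := (G.rev e.1, α.toFun e.1 * e.2)
  rev_rev e := by simp [G.rev_rev, α.map_rev]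
  rev_ne e h := G.rev_ne e.1 (congrArg Prod.fst h)
  src_rev e := by simp [G.src_rev]

/-- The projection of the derived graph. -/
def projection : C(α.derived.Realization, G.Realization) where
  toFun := Realization.lift (fun x => G.pt x.1) (fun e t => G.onEdge e.1 t)
    (fun _ => onEdge_zero _) (fun _ => onEdge_one _) (fun _ _ => onEdge_rev _ _)
  continuous_toFun := Realization.continuous_lift _ _ _ fun _ => continuous_onEdge _

/-- The action on the oriented edges of the derived graph. -/
def translateDart (h : F) (e : α.derived.D) : α.derived.D := (e.1, e.2 * h⁻¹)

/-- The action on the realization of the derived graph. -/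
def translate (h : F) : α.derived.Realization → α.derived.Realization :=
  Realization.lift (fun x => α.derived.pt (x.1, x.2 * h⁻¹))
    (fun e t => α.derived.onEdge (α.translateDart h e) t)
    (fun e => onEdge_zero (G := α.derived) _)
    (fun e => by
      refine (onEdge_one (G := α.derived) _).trans (congrArg _ ?_)
      exact congrArg (Prod.mk _) (mul_assoc _ _ _).symm)
    (fun e t => by
      refine Eq.trans (congrArg (fun d => α.derived.onEdge d t) ?_)
        (onEdge_rev (G := α.derived) _ t)
      exact congrArg (Prod.mk _) (mul_assoc _ _ _))

/-- Voltages multiply on the left, so right multiplication by `h⁻¹` commutes with them and is a left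
action by graph automorphisms. -/
instance : MulAction F α.derived.Realization where
  smul := α.translate
  one_smul z := by
    change α.translate 1 z = z
    induction z using Realization.ind with
    | hpt x => exact congrArg α.derived.pt (by simp)
    | hon e t => exact congrArg (fun d => α.derived.onEdge d t) (Prod.ext rfl (by simp [translateDart]))
  mul_smul h k z := by
    change α.translate (h * k) z = α.translate h (α.translate k z)
    induction z using Realization.ind with
    | hpt x => exact congrArg α.derived.pt (by simp [mul_assoc])
    | hon e t => exact congrArg (fun d => α.derived.onEdge d t) (Prod.ext rfl (by simp [translateDart, mul_assoc]))

theorem smul_onEdge (h : F) (e : α.derived.D) (t : I) :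
    h • α.derived.onEdge e t = α.derived.onEdge (α.translateDart h e) t := rfl

/-- The map from the realization of a graph to the orbit space of the derived graph. -/
def toOrbit : G.Realization → MulAction.orbitRel.Quotient F α.derived.Realization :=
  Realization.lift (fun x => Quotient.mk'' (α.derived.pt (x, 1)))
    (fun e t => Quotient.mk'' (α.derived.onEdge (e, 1) t))
    (fun e => congrArg Quotient.mk'' (onEdge_zero (G := α.derived) _))
    (fun e => Quotient.sound' ⟨(α.toFun e)⁻¹, by
      refine Eq.trans ?_ (onEdge_one (G := α.derived) (e, 1)).symm
      refine congrArg α.derived.pt ?_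
      simp [derived]⟩)
    (fun e t => by
      refine Quotient.sound' ⟨α.toFun e, ?_⟩
      refine (congrArg (α.toFun e • ·) (onEdge_rev (G := α.derived) (e, 1) t).symm).trans ?_
      refine congrArg (fun d => α.derived.onEdge d t) (Prod.ext rfl ?_)
      simp [derived, translateDart])

/-- This shows that points with the same projection lie in one orbit. -/
theorem toOrbit_projection (z : α.derived.Realization) :
    α.toOrbit (α.projection z) = Quotient.mk'' z := by
  induction z using Realization.ind with
  | hpt x =>
    refine Quotient.sound' ⟨x.2, ?_⟩
    exact congrArg α.derived.pt (by simp)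
  | hon e t =>
    refine Quotient.sound' ⟨e.2, ?_⟩
    exact congrArg (fun d => α.derived.onEdge d t) (Prod.ext rfl (by simp [translateDart]))

theorem projection_smul (h : F) (z : α.derived.Realization) :
    α.projection (h • z) = α.projection z := by
  induction z using Realization.ind with
  | hpt x => rfl
  | hon e t => rfl

/-- A nontrivial translation changes the group coordinate, so it moves every vertex star and every
open edge off itself. -/
theorem isQuotientCoveringMap : IsQuotientCoveringMap α.projection F where
  toIsQuotientMap := by
    refine (Topology.isQuotientMap_iff _).2 ⟨Topology.isCoinducing_iff.2 fun U =>
      ⟨fun h => Realization.isOpen_iff.2 fun e => ?_, fun h => h.preimage (map_continuous _)⟩,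
      fun z => ?_⟩
    · exact Realization.isOpen_iff.1 h (e, 1)
    · induction z using Realization.ind with
      | hpt x => exact ⟨α.derived.pt (x, 1), rfl⟩
      | hon e t => exact ⟨α.derived.onEdge (e, 1) t, rfl⟩
  continuous_const_smul h := show Continuous (α.translate h) from Realization.continuous_lift _ _ _ fun e => continuous_onEdge _
  apply_eq_iff_mem_orbit {z₁ z₂} := by
    constructor
    · intro h
      have := congrArg α.toOrbit h
      rw [toOrbit_projection, toOrbit_projection] at this
      exact Quotient.exact' this
    · rintro ⟨h, rfl⟩
      exact α.projection_smul h z₂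
  disjoint z := by
    have key (x : V × F) (h : F) (hx : (x.1, x.2 * h⁻¹) = x) : h = 1 := by
      simpa using congrArg Prod.snd hx
    rcases exists_star_or_bump z with ⟨x, hx⟩ | ⟨e, he⟩
    · refine ⟨{z | 0 < star x z}, (isOpen_lt continuous_const (continuous_star x)).mem_nhds hx, ?_⟩
      rintro h ⟨_, ⟨z, hz, rfl⟩, hz'⟩
      change 0 < star x z at hz
      change 0 < star x (h • z) at hz'
      induction z using Realization.ind with
      | hpt y =>
        have h1 := eq_of_star_pt_pos hz
        have h2 := eq_of_star_pt_pos (G := α.derived) hz'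
        exact key y h (h2.trans h1.symm)
      | hon e t =>
        rw [smul_onEdge] at hz'
        rcases star_onEdge_pos hz with ⟨h1, ht⟩ | ⟨h1, ht⟩ <;>
        rcases star_onEdge_pos hz' with ⟨h2, ht'⟩ | ⟨h2, ht'⟩
        · exact key (α.derived.src e) h (h2.trans h1.symm)
        -- A single point cannot lie in both the first and the last third of its edge.
        · linarith
        · linarith
        · refine key (α.derived.tgt e) h (Eq.trans ?_ (h2.trans h1.symm))
          simp [derived, translateDart, mul_assoc]
    · refine ⟨{z | 0 < bump e z}, (isOpen_lt continuous_const (continuous_bump e)).mem_nhds he, ?_⟩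
      rintro h ⟨_, ⟨z, hz, rfl⟩, hz'⟩
      change 0 < bump e z at hz
      change 0 < bump e (h • z) at hz'
      induction z using Realization.ind with
      | hpt y => exact absurd hz (lt_irrefl _)
      | hon f t =>
        rw [smul_onEdge] at hz'
        have key' (a : G.D × F) (ha : (a.1, a.2 * h⁻¹) = a) : h = 1 := by
          simpa using congrArg Prod.snd ha
        rcases bump_onEdge_pos hz with h1 | h1 <;> rcases bump_onEdge_pos hz' with h2 | h2
        · exact key' f (h2.trans h1.symm)
        -- Translations keep the underlying oriented edge of `G`, so they cannot reverse it.
        · refine absurd ?_ (G.rev_ne f.1)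
          rw [h1] at h2 ⊢
          exact (congrArg Prod.fst h2).symm
        · refine absurd ?_ (G.rev_ne e.1)
          rw [h1] at h2
          exact congrArg Prod.fst h2
        · exact key' f (h2.trans h1.symm)

theorem exists_path_lift : {x y : V} → (p : G.Walk x y) → (g : F) →
    ∃ P : Path (α.derived.pt (x, g)) (α.derived.pt (y, p.val α * g)),
      ∀ t, α.projection (P t) = p.toPath t
  | _, _, .nil x, g => ⟨(Path.refl _).cast rfl (by simp [Walk.val]), fun t => rfl⟩
  | _, y, .cons e p, g => by
    obtain ⟨P, hP⟩ := exists_path_lift p (α.toFun e * g)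
    let d : α.derived.D := (e, g)
    let Q : Path (α.derived.pt (α.derived.tgt d)) (α.derived.pt (y, (Walk.cons e p).val α * g)) :=
      P.cast rfl (by simp [Walk.val, mul_assoc])
    refine ⟨(α.derived.edgePath d).trans Q, fun t => ?_⟩
    change α.projection (((α.derived.edgePath d).trans Q) t) = ((G.edgePath e).trans p.toPath) t
    rw [Path.trans_apply, Path.trans_apply]
    split_ifs
    · rfl
    · exact hP _

/-- Homotopic edge paths have the same total voltage. -/
theorem val_eq_of_toHom_eq {x y : V} {p q : G.Walk x y} (h : p.toHom = q.toHom) :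
    p.val α = q.val α := by
  have cov : IsCoveringMap α.projection := α.isQuotientCoveringMap.isCoveringMap
  obtain ⟨P, hP⟩ := α.exists_path_lift p 1
  obtain ⟨Q, hQ⟩ := α.exists_path_lift q 1
  have hpq : p.toPath.Homotopic q.toPath := Path.Homotopic.Quotient.eq.1 h
  have h0 (r : G.Walk x y) : r.toPath 0 = α.projection (α.derived.pt (x, 1)) :=
    r.toPath.source
  -- Lifts of homotopic paths from one point share their endpoint, whose group coordinate is the
  -- total voltage.
  have e := cov.liftPath_apply_one_eq_of_homotopicRel hpq (α.derived.pt (x, 1)) (h0 p) (h0 q)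
  have eP := (cov.eq_liftPath_iff' (γ_0 := h0 p) (Γ := P.toContinuousMap)).2
    ⟨funext hP, P.source⟩
  have eQ := (cov.eq_liftPath_iff' (γ_0 := h0 q) (Γ := Q.toContinuousMap)).2
    ⟨funext hQ, Q.source⟩
  rw [← eP, ← eQ] at e
  have e' : α.derived.pt (y, p.val α * 1) = α.derived.pt (y, q.val α * 1) :=
    P.target.symm.trans (e.trans Q.target)
  simpa using congrArg Prod.snd (pt_injective e')

/-- The total voltage of a morphism between vertices in the fundamental groupoid. -/
def ofHom {x y : V} (q : G.vtx x ⟶ G.vtx y) : F := (exists_walk_toHom_eq q).choose.val α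

@[simp]
theorem ofHom_toHom {x y : V} (p : G.Walk x y) : α.ofHom p.toHom = p.val α :=
  α.val_eq_of_toHom_eq (exists_walk_toHom_eq p.toHom).choose_spec

theorem ofHom_comp {x y z : V} (q : G.vtx x ⟶ G.vtx y) (r : G.vtx y ⟶ G.vtx z) :
    α.ofHom (q ≫ r) = α.ofHom r * α.ofHom q := by
  obtain ⟨p, rfl⟩ := exists_walk_toHom_eq q
  obtain ⟨p', rfl⟩ := exists_walk_toHom_eq r
  rw [← Walk.toHom_append, ofHom_toHom, ofHom_toHom, ofHom_toHom, Walk.val_append]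

/-- The total voltage as a homomorphism on the fundamental group. -/
def piHom (x : V) : FundamentalGroup G.Realization (G.pt x) →* F where
  toFun q := α.ofHom q
  map_one' := α.ofHom_toHom (Walk.nil x)
  map_mul' q r := α.ofHom_comp r q

theorem piHom_toPi1 {x : V} (p : G.Walk x x) : α.piHom x p.toPi1 = p.val α := α.ofHom_toHom p

end Voltage

theorem Walk.toPi1_surjective {x : V} :
    Function.Surjective (Walk.toPi1 : G.Walk x x → FundamentalGroup G.Realization (G.pt x)) :=
  fun q => exists_walk_toHom_eq q

/-! ### Reduced edge paths -/

namespace Walk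

/-- Only the junction can fail to be reduced: either `e` cancels against the first edge of `p`, or
nothing changes. The free vertex `z` permits case analysis on `p`. -/
theorem exists_cons_reduced (e : G.D) {z y : V} (p : G.Walk z y) (hz : G.tgt e = z)
    (hp : p.IsReduced) : ∃ q : G.Walk (G.src e) y, q.IsReduced ∧ q.darts ⊆ e :: p.darts ∧
      q.toHom = edgeHom e ≫ eqToHom (congrArg _ hz) ≫ p.toHom := by
  cases p with
  | nil =>
    subst hz
    exact ⟨single e, List.isChain_singleton e, by simp [darts], by simp⟩
  | cons f p =>
    by_cases hf : f = G.rev e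
    · subst hf
      refine ⟨p.copy (tgt_rev e) rfl, ?_, ?_, ?_⟩
      · rw [IsReduced, darts_copy]
        exact List.IsChain.tail hp
      · rw [darts_copy]
        exact fun a ha => List.mem_cons_of_mem _ (List.mem_cons_of_mem _ ha)
      · rw [toHom_copy, toHom_cons, edgeHom_rev]
        simp
    · refine ⟨cons e ((cons f p).copy hz.symm rfl), ?_, ?_, ?_⟩
      · simp only [IsReduced, darts, darts_copy, List.isChain_cons_cons]
        exact ⟨hf, hp⟩
      · simp [darts]
      · rw [toHom_cons, toHom_copy]
        simp

/-- Every edge path is homotopic to a reduced one that uses no other oriented edges. -/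
theorem exists_reduced : {x y : V} → (p : G.Walk x y) →
    ∃ q : G.Walk x y, q.IsReduced ∧ q.darts ⊆ p.darts ∧ q.toHom = p.toHom
  | _, _, nil x => ⟨nil x, List.isChain_nil, fun _ h => h, rfl⟩
  | _, _, cons e p => by
    obtain ⟨q, hq, hd, h⟩ := exists_reduced p
    obtain ⟨r, hr, hd', h'⟩ := exists_cons_reduced e q rfl hq
    refine ⟨r, hr, fun a ha => ?_, ?_⟩
    · rcases List.mem_cons.1 (hd' ha) with rfl | h1
      · exact List.mem_cons_self
      · exact List.mem_cons_of_mem _ (hd h1)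
    · rw [h', h]; simp

theorem toHom_eq_id_of_darts {x : V} {p : G.Walk x x} (h : p.darts = []) : p.toHom = 𝟙 _ := by
  cases p with
  | nil => rfl
  | cons e p => exact absurd h (List.cons_ne_nil _ _)

end Walk

/-! ### Orientations of the edges -/

theorem edge_rev (e : G.D) : G.edge (G.rev e) = G.edge e :=
  (Quot.sound (r := fun e e' : G.D => e' = G.rev e) rfl).symm

/-- The set `{a, rev a}` is an invariant of the class that separates edges. -/
theorem edge_eq_iff {e f : G.D} : G.edge e = G.edge f ↔ f = e ∨ f = G.rev e := by
  constructor
  · intro h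
    let φ : G.Edge → Set G.D := Quot.lift (fun a => {a, G.rev a}) (by
      rintro a _ rfl
      rw [G.rev_rev]
      exact Set.pair_comm _ _)
    have h1 : φ (G.edge e) = φ (G.edge f) := congrArg φ h
    have h2 : f ∈ φ (G.edge f) := Or.inl rfl
    rw [← h1] at h2
    exact h2
  · rintro (rfl | rfl)
    exacts [rfl, (edge_rev e).symm]

/-- The chosen orientation of an edge. -/
def Edge.rep (E : G.Edge) : G.D := Quot.out E

theorem Edge.edge_rep (E : G.Edge) : G.edge E.rep = E := Quot.out_eq E

theorem eq_rep_or (e : G.D) : e = (G.edge e).rep ∨ e = G.rev (G.edge e).rep :=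
  edge_eq_iff.1 (G.edge e).edge_rep

open Classical in
/-- Whether an oriented edge has the chosen orientation. -/
def sign (e : G.D) : Bool := decide (e = (G.edge e).rep)

theorem sign_rev (e : G.D) : sign (G.rev e) = !sign e := by
  classical
  have h : (G.edge e).rep = e ∨ (G.edge e).rep = G.rev e := edge_eq_iff.1 (Edge.edge_rep _).symm
  rw [sign, sign, edge_rev]
  rcases h with h | h <;> rw [h]
  · simp [G.rev_ne]
  · simp [(G.rev_ne e).symm]

theorem sign_rep (E : G.Edge) : sign E.rep = true := by
  classical
  simp [sign, E.edge_rep]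

/-- The tautological voltage with values in the free group on the edges. -/
def freeVoltage (G : Multigraph.{u, v} V) : G.Voltage (FreeGroup G.Edge) where
  toFun e := FreeGroup.mk [(G.edge e, sign e)]
  map_rev e := by rw [edge_rev, sign_rev, FreeGroup.inv_mk]; rfl

theorem Walk.val_freeVoltage : {x y : V} → (p : G.Walk x y) →
    p.val G.freeVoltage = FreeGroup.mk (p.darts.map fun e => (G.edge e, sign e)).reverse
  | _, _, nil x => rfl
  | _, _, cons e p => by
    simp only [val, val_freeVoltage p, darts, List.map_cons, List.reverse_cons,
      ← FreeGroup.mul_mk]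
    rfl

/-- A reduced closed edge path that is null-homotopic has no edges. -/
theorem Walk.IsReduced.darts_eq_nil {x : V} {p : G.Walk x x} (hp : p.IsReduced)
    (h : p.toHom = 𝟙 _) : p.darts = [] := by
  classical
  have h1 : p.val G.freeVoltage = 1 :=
    G.freeVoltage.val_eq_of_toHom_eq (q := Walk.nil x) h
  rw [val_freeVoltage] at h1
  -- Adjacent letters that cancel would come from an oriented edge next to its opposite, which
  -- reducedness of the path excludes.
  have hr : FreeGroup.IsReduced (p.darts.map fun e => (G.edge e, sign e)).reverse := by
    rw [FreeGroup.IsReduced, List.isChain_reverse, List.isChain_map]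
    refine List.IsChain.imp (fun a b hab => ?_) hp
    intro he
    rcases edge_eq_iff.1 he with rfl | rfl
    · rfl
    · rw [G.rev_rev] at hab
      exact absurd rfl hab
  have h2 := congrArg FreeGroup.toWord h1
  rw [FreeGroup.toWord_mk, hr.reduce_eq, FreeGroup.toWord_one] at h2
  simpa using h2

/-- The composition of a voltage with a homomorphism. -/
def Voltage.map {F : Type*} {F' : Type*} [Group F] [Group F'] (α : G.Voltage F) (φ : F →* F') :
    G.Voltage F' where
  toFun e := φ (α.toFun e)
  map_rev e := by rw [α.map_rev, map_inv]

theorem Walk.val_map {F : Type*} {F' : Type*} [Group F] [Group F'] (α : G.Voltage F)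
    (φ : F →* F') : {x y : V} → (p : G.Walk x y) → p.val (α.map φ) = φ (p.val α)
  | _, _, nil _ => (map_one φ).symm
  | _, _, cons e p => by rw [val, val, map_mul, val_map α φ p]; rfl

/-! ### The fundamental group of a graph with a spanning tree -/

namespace RootedSpanningTree

variable (τ : G.RootedSpanningTree)

theorem edge_mem_edges {e : G.D} : G.edge e ∈ τ.edges ↔ e ∈ τ.darts := by
  refine ⟨?_, fun h => ⟨e, h, rfl⟩⟩
  rintro ⟨f, hf, h⟩
  rcases edge_eq_iff.1 h with rfl | rfl
  exacts [hf, τ.rev_mem f hf]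

/-- The path in the tree from the root to a vertex. -/
def walkTo (x : V) : G.Walk τ.root x := (τ.connected τ.root x).choose

theorem walkTo_mem {x : V} {e : G.D} (h : e ∈ (τ.walkTo x).darts) : e ∈ τ.darts :=
  (τ.connected τ.root x).choose_spec e h

/-- Reducing keeps the path inside the tree, where acyclicity leaves nothing. -/
theorem toHom_eq_id {x : V} {p : G.Walk x x} (h : ∀ e ∈ p.darts, e ∈ τ.darts) :
    p.toHom = 𝟙 _ := by
  obtain ⟨q, hq, hd, hh⟩ := p.exists_reduced
  rw [← hh]
  exact Walk.toHom_eq_id_of_darts (τ.acyclic x q (fun e he => h e (hd he)) hq)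

/-- The closed edge path at the root that runs through an oriented edge and otherwise stays in
the tree. -/
def loop (e : G.D) : G.Walk τ.root τ.root :=
  (τ.walkTo (G.src e)).append ((Walk.single e).append (τ.walkTo (G.tgt e)).reverse)

theorem toHom_loop (e : G.D) : (τ.loop e).toHom =
    (τ.walkTo (G.src e)).toHom ≫ edgeHom e ≫ Groupoid.inv (τ.walkTo (G.tgt e)).toHom := by
  simp [loop]

theorem toHom_walkTo_congr {x y : V} (h : x = y) :
    (τ.walkTo x).toHom ≫ eqToHom (congrArg _ h) = (τ.walkTo y).toHom := by
  subst h; simp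

/-- The classes of the closed edge paths `loop e`, as a voltage. -/
def loopVoltage : G.Voltage (FundamentalGroup G.Realization (G.pt τ.root)) where
  toFun e := (τ.loop e).toPi1
  map_rev e := by
    refine eq_inv_of_mul_eq_one_left ?_
    change (τ.loop e).toHom ≫ (τ.loop (G.rev e)).toHom = 𝟙 _
    rw [toHom_loop, toHom_loop, ← τ.toHom_walkTo_congr (G.src_rev e).symm,
      ← τ.toHom_walkTo_congr (tgt_rev e).symm, edgeHom_rev]
    simp

/-- The tree paths inserted between consecutive edges cancel; only the outermost two remain. -/
theorem val_loopVoltage : {x y : V} → (p : G.Walk x y) →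
    p.val τ.loopVoltage =
      ((τ.walkTo x).toHom ≫ p.toHom ≫ Groupoid.inv (τ.walkTo y).toHom :
        G.vtx τ.root ⟶ G.vtx τ.root)
  | _, _, .nil x => by simp [Walk.val]
  | _, y, .cons e p => by
    rw [Walk.val, val_loopVoltage p]
    change (τ.loop e).toHom ≫ _ = _
    rw [toHom_loop]
    simp

theorem loopVoltage_eq_one {e : G.D} (h : e ∈ τ.darts) : τ.loopVoltage.toFun e = 1 := by
  refine τ.toHom_eq_id fun f hf => ?_
  simp only [loop, Walk.darts_append, Walk.darts_single, Walk.darts_reverse, List.mem_append,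
    List.mem_singleton, List.mem_reverse, List.mem_map] at hf
  rcases hf with hf | rfl | ⟨a, ha, rfl⟩
  exacts [τ.walkTo_mem hf, h, τ.rev_mem _ (τ.walkTo_mem ha)]

open Classical in
/-- The homomorphism that forgets the edges of the tree. -/
def forget : FreeGroup G.Edge →* FreeGroup {E : G.Edge // E ∉ τ.edges} :=
  FreeGroup.lift fun E => if h : E ∈ τ.edges then 1 else FreeGroup.of ⟨E, h⟩

/-- The voltage with values in the free group on the edges outside the tree. -/
def voltage : G.Voltage (FreeGroup {E : G.Edge // E ∉ τ.edges}) := G.freeVoltage.map τ.forget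

theorem freeVoltage_rep (E : G.Edge) : G.freeVoltage.toFun E.rep = FreeGroup.of E := by
  simp only [freeVoltage, sign_rep, E.edge_rep]; rfl

theorem voltage_rep (E : {E : G.Edge // E ∉ τ.edges}) :
    τ.voltage.toFun E.1.rep = FreeGroup.of E := by
  change τ.forget (G.freeVoltage.toFun E.1.rep) = _
  rw [freeVoltage_rep, forget, FreeGroup.lift_apply_of, dif_neg E.2]

theorem voltage_eq_one {e : G.D} (h : e ∈ τ.darts) : τ.voltage.toFun e = 1 := by
  have h1 : τ.voltage.toFun (G.edge e).rep = 1 := by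
    change τ.forget (G.freeVoltage.toFun (G.edge e).rep) = _
    rw [freeVoltage_rep, forget, FreeGroup.lift_apply_of, dif_pos (τ.edge_mem_edges.2 h)]
  rcases eq_rep_or e with h2 | h2
  · rw [h2, h1]
  · rw [h2, τ.voltage.map_rev, h1, inv_one]

/-- The homomorphism from the free group on the edges outside the tree to the fundamental
group. -/
def ofFree : FreeGroup {E : G.Edge // E ∉ τ.edges} →*
    FundamentalGroup G.Realization (G.pt τ.root) :=
  FreeGroup.lift fun E => (τ.loop E.1.rep).toPi1

/-- Both sides are trivial on the tree, agree on chosen orientations outside it, and are inverted by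
reversal. -/
theorem ofFree_voltage (e : G.D) : τ.ofFree (τ.voltage.toFun e) = τ.loopVoltage.toFun e := by
  by_cases h : e ∈ τ.darts
  · rw [τ.voltage_eq_one h, τ.loopVoltage_eq_one h, map_one]
  · have h' : G.edge e ∉ τ.edges := fun h1 => h (τ.edge_mem_edges.1 h1)
    have h1 : τ.ofFree (τ.voltage.toFun (G.edge e).rep) = τ.loopVoltage.toFun (G.edge e).rep := by
      rw [τ.voltage_rep ⟨_, h'⟩, ofFree, FreeGroup.lift_apply_of]; rfl
    rcases eq_rep_or e with h2 | h2
    · rw [h2, h1]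
    · rw [h2, τ.voltage.map_rev, τ.loopVoltage.map_rev, map_inv, h1]

theorem val_eq_one {x y : V} {p : G.Walk x y} (h : ∀ e ∈ p.darts, e ∈ τ.darts) :
    p.val τ.voltage = 1 := by
  rw [Walk.val_eq_prod]
  refine List.prod_eq_one fun a ha => ?_
  simp only [List.mem_reverse, List.mem_map] at ha
  obtain ⟨e, he, rfl⟩ := ha
  exact τ.voltage_eq_one (h e he)

theorem val_loop (e : G.D) : (τ.loop e).val τ.voltage = τ.voltage.toFun e := by
  simp [loop, τ.val_eq_one fun e he => τ.walkTo_mem he, Walk.single, Walk.val]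

/-- The fundamental group of a graph with a spanning tree is free on the edges outside the
tree. -/
def piEquiv : FundamentalGroup G.Realization (G.pt τ.root) ≃*
    FreeGroup {E : G.Edge // E ∉ τ.edges} where
  toFun := τ.voltage.piHom τ.root
  invFun := τ.ofFree
  left_inv q := by
    obtain ⟨p, rfl⟩ := Walk.toPi1_surjective q
    rw [Voltage.piHom_toPi1, ← Walk.val_map]
    have h : τ.voltage.map τ.ofFree = τ.loopVoltage := by
      have : (τ.voltage.map τ.ofFree).toFun = τ.loopVoltage.toFun := funext τ.ofFree_voltage
      cases h1 : τ.voltage.map τ.ofFree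
      cases h2 : τ.loopVoltage
      rw [h1, h2] at this
      simpa using this
    -- The chosen tree path from the root to itself need not be empty, but it is null-homotopic.
    have h1 : (τ.walkTo τ.root).toHom = 𝟙 _ := τ.toHom_eq_id fun e he => τ.walkTo_mem he
    rw [h, val_loopVoltage, h1]
    simp
    rfl
  right_inv w := by
    have : (τ.voltage.piHom τ.root).comp τ.ofFree = MonoidHom.id _ := by
      refine FreeGroup.ext_hom _ _ fun E => ?_
      rw [MonoidHom.comp_apply, ofFree, FreeGroup.lift_apply_of, Voltage.piHom_toPi1, val_loop,
        voltage_rep]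
      rfl
    exact DFunLike.congr_fun this w
  map_mul' := map_mul _

theorem card_compl_edges [Finite G.Edge] :
    Nat.card {E : G.Edge // E ∉ τ.edges} = Nat.card G.Edge - τ.edges.ncard := by
  have := Set.ncard_add_ncard_compl τ.edges
  have h : Nat.card {E : G.Edge // E ∉ τ.edges} = τ.edgesᶜ.ncard := rfl
  omega

theorem nonempty_piEquiv [Finite G.Edge] {n : ℕ}
    (hn : n = Nat.card G.Edge - τ.edges.ncard) :
    Nonempty (FundamentalGroup G.Realization (G.pt τ.root) ≃* FreeGroup (Fin n)) := by
  rw [← card_compl_edges] at hn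
  exact ⟨τ.piEquiv.trans (FreeGroup.freeGroupCongr (Finite.equivFinOfCardEq hn.symm))⟩

/-- The spanning tree with another root. -/
def withRoot (x : V) : G.RootedSpanningTree := { τ with root := x }

/-! ### The contraction of the tree -/

/-- The graph with one vertex whose edges are the edges outside the tree. -/
def bouquet : Multigraph.{0, v} Unit where
  D := {e : G.D // e ∉ τ.darts}
  src _ := ()
  tgt _ := ()
  rev e := ⟨G.rev e.1, fun h => e.2 (by simpa [G.rev_rev] using τ.rev_mem _ h)⟩
  rev_rev e := Subtype.ext (G.rev_rev e.1)
  rev_ne e h := G.rev_ne e.1 (congrArg Subtype.val h)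
  src_rev _ := rfl

open Classical in
/-- The map that sends the edges outside the tree to themselves and the tree to the vertex. -/
def toBouquet : C(G.Realization, τ.bouquet.Realization) where
  toFun := Realization.lift (fun _ => τ.bouquet.pt ())
    (fun e t => if h : e ∈ τ.darts then τ.bouquet.pt () else τ.bouquet.onEdge ⟨e, h⟩ t)
    (fun e => by
      split_ifs
      exacts [rfl, onEdge_zero (G := τ.bouquet) _])
    (fun e => by
      split_ifs
      exacts [rfl, onEdge_one (G := τ.bouquet) _])
    (fun e t => by
      by_cases h : e ∈ τ.darts
      · rw [dif_pos h, dif_pos (τ.rev_mem e h)]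
      · have h' : G.rev e ∉ τ.darts := fun h1 => h (by simpa [G.rev_rev] using τ.rev_mem _ h1)
        rw [dif_neg h, dif_neg h']
        exact onEdge_rev (G := τ.bouquet) ⟨e, h⟩ t)
  continuous_toFun := Realization.continuous_lift _ _ _ fun e => by
    split_ifs
    exacts [continuous_const, continuous_onEdge _]

theorem toBouquet_of_mem {e : G.D} (h : e ∈ τ.darts) (t : I) :
    τ.toBouquet (G.onEdge e t) = τ.bouquet.pt () := dif_pos h

theorem toBouquet_of_notMem {e : G.D} (h : e ∉ τ.darts) (t : I) :
    τ.toBouquet (G.onEdge e t) = τ.bouquet.onEdge ⟨e, h⟩ t := dif_neg h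

theorem toBouquet_points {z : G.Realization} (hz : z ∈ τ.points) :
    τ.toBouquet z = τ.bouquet.pt () := by
  rcases hz with ⟨x, rfl⟩ | ⟨e, he, t, rfl⟩
  exacts [rfl, τ.toBouquet_of_mem he t]

/-- The map from the contraction to the realization of the bouquet. -/
def contractionToBouquet : C(τ.Contraction, τ.bouquet.Realization) where
  toFun := Quot.lift τ.toBouquet fun _ _ h =>
    (τ.toBouquet_points h.1).trans (τ.toBouquet_points h.2).symm
  continuous_toFun := continuous_quot_lift _ τ.toBouquet.continuous

/-- The voltage on the bouquet given by the free group on the edges outside the tree. -/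
def bouquetVoltage : τ.bouquet.Voltage (FreeGroup {E : G.Edge // E ∉ τ.edges}) where
  toFun e := τ.voltage.toFun e.1
  map_rev e := τ.voltage.map_rev e.1

/-- Deleting the tree edges of `p` gives `q`; they become constant in the bouquet and carry trivial
voltage. -/
theorem exists_bouquet_walk : {x y : V} → (p : G.Walk x y) → ∃ q : τ.bouquet.Walk () (),
    q.toHom = (FundamentalGroupoid.map τ.contractionToBouquet).map
        ((FundamentalGroupoid.map τ.contract).map p.toHom) ∧
      q.val τ.bouquetVoltage = p.val τ.voltage
  | _, _, .nil x => ⟨.nil _, rfl, rfl⟩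
  | _, _, .cons e p => by
    obtain ⟨q, hq, hv⟩ := exists_bouquet_walk p
    by_cases h : e ∈ τ.darts
    · refine ⟨q, ?_, ?_⟩
      · rw [Walk.toHom_cons, Functor.map_comp, Functor.map_comp, ← hq]
        have : (FundamentalGroupoid.map τ.contractionToBouquet).map
            ((FundamentalGroupoid.map τ.contract).map (edgeHom e)) =
            𝟙 (τ.bouquet.vtx ()) := by
          refine congrArg (Path.Homotopic.Quotient.mk (X := τ.bouquet.Realization))
            (Path.ext (funext fun t => ?_) : _ = Path.refl _)
          exact τ.toBouquet_of_mem h t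
        rw [this]
        exact (Category.id_comp _).symm
      · rw [Walk.val, τ.voltage_eq_one h, mul_one, hv]
    · let d : τ.bouquet.D := ⟨e, h⟩
      refine ⟨.cons d q, ?_, ?_⟩
      · rw [Walk.toHom_cons, Walk.toHom_cons, Functor.map_comp, Functor.map_comp, ← hq]
        have : (FundamentalGroupoid.map τ.contractionToBouquet).map
            ((FundamentalGroupoid.map τ.contract).map (edgeHom e)) = edgeHom d := by
          refine congrArg (Path.Homotopic.Quotient.mk (X := τ.bouquet.Realization))
            (Path.ext (funext fun t => ?_) : _ = τ.bouquet.edgePath d)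
          exact τ.toBouquet_of_notMem h t
        rw [this]
        rfl
      · rw [Walk.val, Walk.val, hv]; rfl

/-- The contraction of a spanning tree is injective on fundamental groups. -/
theorem map_contract_injective :
    Function.Injective (FundamentalGroup.map τ.contract (G.pt τ.root)) := by
  intro a b hab
  obtain ⟨p, rfl⟩ := Walk.toPi1_surjective a
  obtain ⟨p', rfl⟩ := Walk.toPi1_surjective b
  obtain ⟨q, hq, hv⟩ := τ.exists_bouquet_walk p
  obtain ⟨q', hq', hv'⟩ := τ.exists_bouquet_walk p'
  have h : q.toHom = q'.toHom := by
    rw [hq, hq']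
    exact congrArg (FundamentalGroupoid.map τ.contractionToBouquet).map hab
  -- The class in the bouquet determines the voltage, which by `piEquiv` determines the class in
  -- `G`.
  apply τ.piEquiv.injective
  change τ.voltage.piHom _ _ = τ.voltage.piHom _ _
  rw [Voltage.piHom_toPi1, Voltage.piHom_toPi1, ← hv, ← hv',
    τ.bouquetVoltage.val_eq_of_toHom_eq h]

/-- Elements of the fundamental group whose images generate the fundamental group of the
contraction generate the fundamental group. -/
theorem closure_eq_top {ι : Type*} {l : ι → FundamentalGroup G.Realization (G.pt τ.root)}
    (h : Subgroup.closure
      (Set.range fun i => FundamentalGroup.map τ.contract (G.pt τ.root) (l i)) = ⊤) :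
    Subgroup.closure (Set.range l) = ⊤ := by
  refine (Subgroup.eq_top_iff' _).2 fun c => ?_
  have hc : FundamentalGroup.map τ.contract (G.pt τ.root) c ∈
      (Subgroup.closure (Set.range l)).map (FundamentalGroup.map τ.contract (G.pt τ.root)) := by
    rw [MonoidHom.map_closure, ← Set.range_comp]
    exact h.ge (Subgroup.mem_top _)
  obtain ⟨k, hk, he⟩ := hc
  rwa [← τ.map_contract_injective he]

end RootedSpanningTree

end Multigraph

/-! ### Commutator subgroups and linear independence -/

theorem MonoidHom.map_mem_commutator {A B : Type*} [Group A] [Group B] (f : A →* B) {a : A}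
    (ha : a ∈ commutator A) : f a ∈ commutator B := by
  rw [← Abelianization.ker_of, MonoidHom.mem_ker] at ha ⊢
  rw [← Abelianization.map_of, ha, map_one]

theorem MonoidHom.eq_one_of_mem_commutator {A B : Type*} [Group A] [CommGroup B] (f : A →* B)
    {a : A} (ha : a ∈ commutator A) : f a = 1 :=
  Abelianization.commutator_subset_ker f ha

theorem MulEquiv.map_commutator {A B : Type*} [Group A] [Group B] (f : A ≃* B) :
    (commutator A).map f.toMonoidHom = commutator B := by
  refine le_antisymm ?_ fun b hb => ?_
  · rintro _ ⟨a, ha, rfl⟩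
    exact f.toMonoidHom.map_mem_commutator ha
  · exact ⟨f.symm b, f.symm.toMonoidHom.map_mem_commutator hb, f.apply_symm_apply b⟩

/-- If a group is generated by elements whose images under a homomorphism to a real vector space
are linearly independent, then the kernel of the homomorphism lies in the commutator subgroup. -/
theorem mem_commutator_of_linearIndependent {A E ι : Type*} [Group A] [AddCommGroup E] [Module ℝ E]
    [Fintype ι] {l : ι → A} (hl : Subgroup.closure (Set.range l) = ⊤)
    (f : A →* Multiplicative E) (hf : LinearIndependent ℝ fun i => (f (l i)).toAdd) {a : A}
    (ha : f a = 1) : a ∈ commutator A := by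
  classical
  have key (a : A) (hmem : a ∈ Subgroup.closure (Set.range l)) :
      ∃ c : ι → ℤ, Abelianization.of a = ∏ i, Abelianization.of (l i) ^ c i := by
    induction hmem using Subgroup.closure_induction with
    | mem x hx =>
      obtain ⟨i, rfl⟩ := hx
      refine ⟨Pi.single i 1, ?_⟩
      rw [Finset.prod_eq_single i (fun j _ hj => by simp [hj]) (by simp)]
      simp
    | one => exact ⟨0, by simp⟩
    | mul x y _ _ hx hy =>
      obtain ⟨b, hb⟩ := hx
      obtain ⟨c, hc⟩ := hy
      exact ⟨b + c, by simp [hb, hc, zpow_add, Finset.prod_mul_distrib]⟩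
    | inv x _ hx =>
      obtain ⟨b, hb⟩ := hx
      exact ⟨-b, by simp [hb, zpow_neg]⟩
  obtain ⟨c, hc⟩ := key a (hl ▸ Subgroup.mem_top a)
  have h1 := congrArg (fun x => (Abelianization.lift f x).toAdd) hc
  simp only [Abelianization.lift_apply_of, ha, map_prod, map_zpow, toAdd_prod, toAdd_zpow,
    toAdd_one] at h1
  -- Applying `f` to the monomial gives a vanishing integer combination of independent vectors.
  have h2 : ∀ i, (c i : ℝ) = 0 := by
    refine Fintype.linearIndependent_iff.1 hf (fun i => (c i : ℝ)) ?_
    simp only [Int.cast_smul_eq_zsmul]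
    exact h1.symm
  rw [← Abelianization.ker_of, MonoidHom.mem_ker, hc]
  refine Finset.prod_eq_one fun i _ => ?_
  rw [Int.cast_eq_zero.1 (h2 i), zpow_zero]

/-! ### Balanced edge paths -/

namespace Multigraph

open FundamentalGroupoid

variable {V : Type u} {G : Multigraph.{u, v} V}

theorem Walk.val_comm {F : Type*} [CommGroup F] (α : G.Voltage F) {x y : V} (p : G.Walk x y) :
    p.val α = (p.darts.map α.toFun).prod := by
  rw [val_eq_prod, List.prod_reverse]

open Classical in
/-- The voltage that counts how often an edge is traversed in each direction. -/
def countVoltage (e : G.D) : G.Voltage (Multiplicative ℤ) where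
  toFun f := .ofAdd ((if f = e then 1 else 0) - (if f = G.rev e then 1 else 0))
  map_rev f := by
    have h1 : G.rev f = e ↔ f = G.rev e := by
      constructor <;> rintro rfl <;> simp [G.rev_rev]
    have h2 : G.rev f = G.rev e ↔ f = e :=
      ⟨fun h => by rw [← G.rev_rev f, h, G.rev_rev], congrArg _⟩
    rw [← ofAdd_neg, neg_sub]
    simp only [h1, h2]

open Classical in
theorem Walk.val_countVoltage (e : G.D) : {x y : V} → (p : G.Walk x y) →
    p.val (countVoltage e) = .ofAdd ((p.darts.count e : ℤ) - p.darts.count (G.rev e))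
  | _, _, nil _ => rfl
  | _, _, cons f p => by
    rw [val, val_countVoltage e p, countVoltage, ← ofAdd_add]
    congr 1
    simp only [darts, List.count_cons, beq_iff_eq]
    push_cast
    ring

/-- Balance becomes the vanishing of homomorphisms to `ℤ`, which commutators satisfy automatically.
-/
theorem Walk.isBalanced_iff {x y : V} (p : G.Walk x y) :
    p.IsBalanced ↔ ∀ e, p.val (countVoltage e) = 1 := by
  classical
  refine forall_congr' fun e => ?_
  rw [val_countVoltage, ofAdd_eq_one, sub_eq_zero, Nat.cast_inj]

/-- Reversing each edge of a balanced path permutes its list of edges, so the sum equals its own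
negative. -/
theorem Walk.IsBalanced.sum_eq_zero {E : Type*} [AddCommGroup E] [Module ℝ E] {x y : V}
    {p : G.Walk x y} (hp : p.IsBalanced) {φ : G.D → E} (hφ : ∀ e, φ (G.rev e) = -φ e) :
    (p.darts.map φ).sum = 0 := by
  classical
  have hperm : (p.darts.map G.rev).Perm p.darts := by
    rw [List.perm_iff_count]
    intro e
    have h1 : (p.darts.map G.rev).count e = p.darts.count (G.rev e) := by
      conv_lhs => rw [← G.rev_rev e]
      exact List.count_map_of_injective _ _ (Function.LeftInverse.injective G.rev_rev) _
    rw [h1]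
    convert (hp e).symm
  have h2 := (hperm.map φ).sum_eq
  rw [List.map_map] at h2
  have h3 : φ ∘ G.rev = fun e => -φ e := funext hφ
  have h4 : ∀ L : List G.D, (L.map fun e => -φ e).sum = -(L.map φ).sum := by
    intro L
    induction L with
    | nil => simp
    | cons e L ih => simp only [List.map_cons, List.sum_cons, ih, neg_add]
  rw [h3, h4] at h2
  have h5 : (2 : ℝ) • (p.darts.map φ).sum = 0 := by
    rw [two_smul, ← neg_eq_iff_add_eq_zero]
    exact h2
  exact (smul_eq_zero.1 h5).resolve_left two_ne_zero

end Multigraph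

namespace LatticeGraph

open Multigraph FundamentalGroupoid

variable {d : ℕ} {C : CrystalStructure d} (Γ : LatticeGraph.{v} C)

/-! ### Displacements -/

theorem vec_projD (e : Γ.D) : Γ.vec (Γ.projD e) =
    (Γ.tgt e : EuclideanSpace ℝ (Fin d)) - (Γ.src e : EuclideanSpace ℝ (Fin d)) := rfl

theorem vec_rev (e : Γ.quotient.D) : Γ.vec (Γ.quotient.rev e) = -Γ.vec e := by
  obtain ⟨e⟩ := e
  change Γ.vec (Γ.projD (Γ.rev e)) = -Γ.vec (Γ.projD e)
  rw [vec_projD, vec_projD, Γ.src_rev, Multigraph.tgt_rev, neg_sub]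

/-- The vectors of the oriented edges of the quotient graph, as a voltage. -/
def vecVoltage : Γ.quotient.Voltage (Multiplicative (EuclideanSpace ℝ (Fin d))) where
  toFun e := .ofAdd (Γ.vec e)
  map_rev e := by rw [vec_rev, ofAdd_neg]

theorem val_vecVoltage {y z : AddAction.orbitRel.Quotient C.L C.lattice}
    (p : Γ.quotient.Walk y z) : p.val Γ.vecVoltage = .ofAdd (Γ.displacement p) := by
  rw [Walk.val_comm, displacement, ofAdd_list_prod, List.map_map]
  rfl

theorem displacement_eq_zero_iff {y z : AddAction.orbitRel.Quotient C.L C.lattice}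
    (p : Γ.quotient.Walk y z) : Γ.displacement p = 0 ↔ p.val Γ.vecVoltage = 1 := by
  rw [val_vecVoltage, ofAdd_eq_one]

/-! ### Lifting edge paths -/

/-- The image of an edge path in the quotient graph. -/
def projWalk : {x y : C.lattice} → Γ.Walk x y → Γ.quotient.Walk (projV x) (projV y)
  | _, _, .nil x => .nil (projV x)
  | _, _, .cons e p => .cons (G := Γ.quotient) (Γ.projD e) (projWalk p)

theorem darts_projWalk : {x y : C.lattice} → (p : Γ.Walk x y) →
    (Γ.projWalk p).darts = p.darts.map Γ.projD
  | _, _, .nil _ => rfl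
  | _, _, .cons e p => congrArg (Γ.projD e :: ·) (darts_projWalk p)

theorem toHom_projWalk : {x y : C.lattice} → (p : Γ.Walk x y) →
    (FundamentalGroupoid.map Γ.proj.realize).map p.toHom = (Γ.projWalk p).toHom
  | _, _, .nil _ => rfl
  | _, _, .cons e p => by
    rw [Walk.toHom_cons, Functor.map_comp, toHom_projWalk p]
    have : (FundamentalGroupoid.map Γ.proj.realize).map (edgeHom e) =
        edgeHom (G := Γ.quotient) (Γ.projD e) := rfl
    rw [this]
    rfl

theorem map_toPi1 {x : C.lattice} (p : Γ.Walk x x) :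
    FundamentalGroup.map Γ.proj.realize (Γ.pt x) p.toPi1 = (Γ.projWalk p).toPi1 :=
  Γ.toHom_projWalk p

/-- The differences of positions telescope. -/
theorem displacement_projWalk : {x y : C.lattice} → (p : Γ.Walk x y) →
    Γ.displacement (Γ.projWalk p) = (y : EuclideanSpace ℝ (Fin d)) - x
  | _, _, .nil _ => (sub_self _).symm
  | _, _, .cons e p => by
    have h : Γ.displacement (Γ.projWalk (.cons e p)) =
      Γ.vec (Γ.projD e) + Γ.displacement (Γ.projWalk p) := by
      rw [displacement, displacement, darts_projWalk, darts_projWalk]; exact List.sum_cons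
    rw [h, displacement_projWalk p, vec_projD]
    abel

theorem exists_dart_lift (e : Γ.quotient.D) (x : C.lattice) (h : projV x = Γ.quotient.src e) :
    ∃ f : Γ.D, Γ.projD f = e ∧ Γ.src f = x := by
  obtain ⟨f⟩ := e
  obtain ⟨g, hg⟩ := Quotient.exact' h
  exact ⟨g +ᵥ f, Γ.projD_vadd g f, (Γ.src_vadd g f).trans hg⟩

theorem exists_walk_lift {y z : AddAction.orbitRel.Quotient C.L C.lattice}
    (c : Γ.quotient.Walk y z) (x : C.lattice) (h : projV x = y) :
    ∃ (x' : C.lattice) (h' : projV x' = z) (p : Γ.Walk x x'), (Γ.projWalk p).copy h h' = c := by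
  induction c generalizing x with
  | nil =>
    subst h
    exact ⟨x, rfl, .nil x, rfl⟩
  | cons e c ih =>
    obtain ⟨f, rfl, rfl⟩ := Γ.exists_dart_lift e x h
    obtain ⟨x', rfl, p, hp⟩ := ih (Γ.tgt f) rfl
    refine ⟨x', rfl, .cons f p, ?_⟩
    exact congrArg (Walk.cons (G := Γ.quotient) (Γ.projD f)) hp

/-- Any lift starting at `x` ends at `x` plus the displacement. -/
theorem exists_closed_lift_iff {y : AddAction.orbitRel.Quotient C.L C.lattice}
    (c : Γ.quotient.Walk y y) (x : C.lattice) (h : projV x = y) :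
    (∃ p : Γ.Walk x x, Γ.IsLift p c) ↔ Γ.displacement c = 0 := by
  constructor
  · rintro ⟨p, -, hp⟩
    have h1 := Γ.displacement_projWalk p
    rw [sub_self, displacement, darts_projWalk] at h1
    rw [displacement, ← hp]
    exact h1
  · intro h0
    subst h
    obtain ⟨x', h', p, hp⟩ := Γ.exists_walk_lift c x rfl
    have h1 := Γ.displacement_projWalk p
    have hd : c.darts = p.darts.map Γ.projD := by rw [← hp, Walk.darts_copy, darts_projWalk]
    rw [displacement, darts_projWalk, ← hd] at h1
    rw [displacement, h1, sub_eq_zero] at h0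
    obtain rfl := Subtype.ext h0
    exact ⟨p, rfl, hd.symm⟩

theorem exists_projWalk_eq {x : C.lattice} (c : Γ.quotient.Walk (projV x) (projV x))
    (h0 : Γ.displacement c = 0) : ∃ p : Γ.Walk x x, Γ.projWalk p = c := by
  obtain ⟨x', h', p, rfl⟩ := Γ.exists_walk_lift c x rfl
  have h1 := Γ.displacement_projWalk p
  rw [displacement, Walk.darts_copy] at h0
  rw [displacement, h0, eq_comm, sub_eq_zero] at h1
  obtain rfl := Subtype.ext h1
  exact ⟨p, rfl⟩

/-- Translations act freely on vertices, so the one relating `e` and `f` is zero. -/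
theorem eq_of_projD_eq {e f : Γ.D} (h : Γ.projD e = Γ.projD f) (hs : Γ.src e = Γ.src f) :
    e = f := by
  obtain ⟨g, hg⟩ := Quotient.exact' h
  change g +ᵥ f = e at hg
  have h1 := Γ.src_vadd g f
  rw [hg, hs] at h1
  have h2 := congrArg Subtype.val h1
  rw [C.coe_vadd, right_eq_add] at h2
  obtain rfl : g = 0 := Subtype.ext h2
  rw [← hg, zero_vadd]

/-- A backtracking downstairs is one upstairs: the next edge and the reversed previous edge have the
same source and the same image, hence coincide. -/
theorem isReduced_projWalk {x y : C.lattice} (p : Γ.Walk x y) (hp : p.IsReduced) :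
    (Γ.projWalk p).IsReduced := by
  induction p with
  | nil => exact List.isChain_nil
  | @cons y e p ih =>
    have key : ∀ (z : C.lattice) (p : Γ.Walk z y), Γ.tgt e = z →
        (e :: p.darts).IsChain (fun a b => b ≠ Γ.rev a) → (Γ.projWalk p).IsReduced →
        (Γ.projD e :: (Γ.projWalk p).darts).IsChain (fun a b => b ≠ Γ.quotient.rev a) := by
      intro z p hz hp ih
      cases p with
      | nil => exact List.isChain_singleton _
      | cons f p =>
        refine List.isChain_cons_cons.2 ⟨fun h => (List.isChain_cons_cons.1 hp).1 ?_, ih⟩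
        exact Γ.eq_of_projD_eq h (by rw [Γ.src_rev, hz])
    exact key _ p rfl hp (ih (List.IsChain.tail hp))

theorem map_proj_injective (x : C.lattice) :
    Function.Injective (FundamentalGroup.map Γ.proj.realize (Γ.pt x)) := by
  refine (injective_iff_map_eq_one _).2 fun a ha => ?_
  obtain ⟨p, rfl⟩ := Walk.toPi1_surjective a
  obtain ⟨q, hq, -, hqp⟩ := p.exists_reduced
  have hpq : p.toPi1 = q.toPi1 := hqp.symm
  rw [hpq, map_toPi1] at ha
  have h := (Γ.isReduced_projWalk q hq).darts_eq_nil ha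
  rw [darts_projWalk] at h
  rw [hpq]
  exact Walk.toHom_eq_id_of_darts (List.map_eq_nil_iff.1 h)

/-! ### Closed edge paths without displacement -/

section

variable {Γ} (τ : Γ.quotient.RootedSpanningTree) {n : ℕ} {l : Fin n → Γ.quotient.Walk τ.root τ.root}
    (hgen : Subgroup.closure
      (Set.range fun i => FundamentalGroup.map τ.contract (Γ.quotient.pt τ.root) (l i).toPi1) = ⊤)
    (hind : LinearIndependent ℝ fun i => Γ.displacement (l i))

include hgen hind in
theorem mem_commutator_root {q : FundamentalGroup Γ.quotient.Realization (Γ.quotient.pt τ.root)}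
    (hq : Γ.vecVoltage.piHom τ.root q = 1) : q ∈ commutator _ := by
  refine mem_commutator_of_linearIndependent (τ.closure_eq_top hgen) (Γ.vecVoltage.piHom τ.root)
    ?_ hq
  simpa only [Voltage.piHom_toPi1, val_vecVoltage, toAdd_ofAdd] using hind

include hgen hind in
-- Conjugating by a tree path moves the loop to the root without changing its displacement, and
-- conjugation preserves commutator subgroups.
theorem mem_commutator_of_displacement_eq_zero {y : AddAction.orbitRel.Quotient C.L C.lattice}
    {p : Γ.quotient.Walk y y} (hp : Γ.displacement p = 0) :
    p.toPi1 ∈ commutator (FundamentalGroup Γ.quotient.Realization (Γ.quotient.pt y)) := by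
  let t := τ.walkTo y
  let φ := (asIso t.toHom).conj
  have h1 : (t.append (p.append t.reverse)).toPi1 ∈ commutator _ := by
    refine mem_commutator_root τ hgen hind ?_
    rw [displacement_eq_zero_iff] at hp
    rw [Voltage.piHom_toPi1, Walk.val_append, Walk.val_append, Walk.val_reverse, hp]
    simp
  have h2 := φ.toMonoidHom.map_mem_commutator h1
  convert h2 using 1
  change p.toHom = (asIso t.toHom).conj (t.append (p.append t.reverse)).toHom
  rw [Iso.conj_apply]
  simp

include hgen hind in
theorem isBalanced_iff_displacement_eq_zero {y : AddAction.orbitRel.Quotient C.L C.lattice}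
    (p : Γ.quotient.Walk y y) : p.IsBalanced ↔ Γ.displacement p = 0 := by
  refine ⟨fun h => h.sum_eq_zero Γ.vec_rev, fun h => p.isBalanced_iff.2 fun e => ?_⟩
  rw [← Voltage.piHom_toPi1]
  exact MonoidHom.eq_one_of_mem_commutator _
    (mem_commutator_of_displacement_eq_zero τ hgen hind h)

include hgen hind in
theorem range_map_proj (x : C.lattice) :
    (FundamentalGroup.map Γ.proj.realize (Γ.pt x)).range = commutator _ := by
  refine le_antisymm ?_ fun c hc => ?_
  · rintro _ ⟨a, rfl⟩
    obtain ⟨p, rfl⟩ := Walk.toPi1_surjective a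
    rw [map_toPi1]
    refine mem_commutator_of_displacement_eq_zero τ hgen hind ?_
    exact (Γ.displacement_projWalk p).trans (sub_self _)
  · obtain ⟨p, rfl⟩ := Walk.toPi1_surjective (G := Γ.quotient) (x := projV x) c
    have h0 : Γ.displacement p = 0 := by
      rw [displacement_eq_zero_iff, ← Voltage.piHom_toPi1]
      exact MonoidHom.eq_one_of_mem_commutator _ hc
    obtain ⟨q, rfl⟩ := Γ.exists_projWalk_eq p h0
    exact ⟨q.toPi1, Γ.map_toPi1 q⟩

end

end LatticeGraph

end

theorem mainTheorem12 {d : ℕ} (C : CrystalStructure d) (Γ : LatticeGraph.{v} C)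
    (hfin : Finite Γ.quotient.Edge) (τ : Γ.quotient.RootedSpanningTree)
    (n : ℕ) (hn : n = Nat.card Γ.quotient.Edge - τ.edges.ncard)
    -- closed edge paths at the root that lift generators of `π₁` of the wedge of circles
    (l : Fin n → Γ.quotient.Walk τ.root τ.root)
    (hgen : Subgroup.closure
      (Set.range fun i => FundamentalGroup.map τ.contract (Γ.quotient.pt τ.root) (l i).toPi1) = ⊤)
    (hind : LinearIndependent ℝ fun i => Γ.displacement (l i)) :
    -- the fundamental group of the quotient graph is free on `n` generators, and the one of `Γ`
    -- is its commutator subgroup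
    Nonempty (FundamentalGroup Γ.quotient.Realization (Γ.quotient.pt τ.root) ≃*
      FreeGroup (Fin n)) ∧
    (∀ x : C.lattice,
      Function.Injective (FundamentalGroup.map Γ.proj.realize (Γ.pt x)) ∧
      (FundamentalGroup.map Γ.proj.realize (Γ.pt x)).range = commutator _ ∧
      Nonempty (FundamentalGroup Γ.Realization (Γ.pt x) ≃* commutator (FreeGroup (Fin n)))) ∧
    -- a loop lifts to a loop iff it traverses each edge equally often in each direction
    (∀ (y : AddAction.orbitRel.Quotient C.L C.lattice) (p : Γ.quotient.Walk y y) (x : C.lattice),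
      Γ.proj.onV x = y →
      ((∃ p' : Γ.Walk x x, Γ.IsLift p' p) ↔ p.IsBalanced)) := by
  refine ⟨τ.nonempty_piEquiv hn, fun x => ?_, fun y p x h => ?_⟩
  · have hinj := Γ.map_proj_injective x
    have hrange := LatticeGraph.range_map_proj τ hgen hind x
    refine ⟨hinj, hrange, ?_⟩
    -- Moving the root keeps the tree edges, so the same `n` serves at every base point.
    obtain ⟨e⟩ := (τ.withRoot (LatticeGraph.projV x)).nonempty_piEquiv hn
    exact ⟨(MonoidHom.ofInjective hinj).trans <| (MulEquiv.subgroupCongr hrange).trans <|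
      (e.subgroupMap (commutator _)).trans (MulEquiv.subgroupCongr e.map_commutator)⟩
  · rw [Γ.exists_closed_lift_iff p x h,
      LatticeGraph.isBalanced_iff_displacement_eq_zero τ hgen hind]
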